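/- **Setting.** Let $\overline M$ be a complex manifold of complex dimension $2n+1$ with complex structure $J$ and an open covering $\{\mathcal O_i\}$ carrying holomorphic 1-forms $\theta_i$ with $\theta_i\wedge(d\theta_i)^n\neq 0$ everywhere on $\mathcal O_i$ and $\theta_i=f_{ij}\theta_j$ on $\mathcal O_i\cap\mathcal O_j$, with $f_{ij}$ holomorphic and nowhere zero (a complex contact manifold). Let $\overline g$ be a Hermitian semi-Riemannian metric of index $4q$, $0<q<n$, and on each $\mathcal O_i$ let $u$, $\sigma$ be 1-forms, $U$ a vector field and $G$ a $(1,1)$-tensor field; put $v=u\circ J$, $V=-JU$, $H=GJ$. Exterior derivatives and wedge products are normalised by $d\alpha(X,Y)=\frac12\{X\alpha(Y)-Y\alpha(X)-\alpha([X,Y])\}$ and $(\alpha\wedge\beta)(X,Y)=\frac12\{\alpha(X)\beta(Y)-\alpha(Y)\beta(X)\}$. Suppose that $\overline M$ is an indefinite complex contact metric manifold, that is, on each $\mathcal O_i$: $$G^2=H^2=-I+u\otimes U+v\otimes V,\quad \overline g(GX,Y)=-\overline g(X,GY),\quad \overline g(U,X)=u(X),\quad GJ=-JG,\quad GU=0,\quad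 u(U)=1,$$ $$du(X,Y)=\overline g(X,GY)+(\sigma\wedge v)(X,Y),\qquad dv(X,Y)=\overline g(X,HY)-(\sigma\wedge u)(X,Y),$$ $u-\sqrt{-1}\,v$ is a nowhere zero complex multiple of $\theta_i$, and on $\mathcal O_i\cap\mathcal O_j$ there are functions $a,b$ with $a^2+b^2=1$, $u_j=au_i-bv_i$, $v_j=bu_i+av_i$, $G_j=aG_i-bH_i$, $H_j=bG_i+aH_i$. Suppose also that $\overline M$ is normal: with $[\cdot,\cdot]$ of a $(1,1)$-tensor denoting its Nijenhuis tensor, and $$\begin{aligned}S(X,Y)={}&[G,G](X,Y)+2\overline g(X,GY)U-2\overline g(X,HY)V+2\{v(Y)HX-v(X)HY\}\\&+\sigma(GY)HX-\sigma(GX)HY+\sigma(X)GHY-\sigma(Y)GHX,\\ T(X,Y)={}&[H,H](X,Y)-2\overline g(X,GY)U+2\overline g(X,HY)V+2\{u(Y)GX-u(X)GY\}\\&+\sigma(HX)GY-\sigma(HY)GX+\sigma(X)GHY-\sigma(Y)GHX,\end{aligned}$$ one has $S(X,Y)=T(X,Y)=0$ whenever $X,Y$ lie in $\ker u\cap\ker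 v$, and $S(U,X)=T(V,X)=0$ for all $X$. Write $J_1=J$, $J_2=G$, $J_3=H$, let $\mathcal V=\mathrm{Span}\{U,V\}$, and let $\overline\nabla$ be the Levi-Civita connection of $\overline g$. Let $M$ be an (immersed) $r$-null submanifold of $\overline M$: $\mathrm{Rad}\,TM=TM\cap TM^\perp$ is a smooth distribution of rank $r>0$. Choose on $M$ a screen distribution $S(TM)$ (a smooth nondegenerate complement of $\mathrm{Rad}\,TM$ in $TM$), a screen transversal bundle $S(TM^\perp)$ (a smooth nondegenerate complement of $\mathrm{Rad}\,TM$ in $TM^\perp$) and a null transversal bundle $l\mathrm{tr}(TM)$ (a subbundle locally spanned by smooth sections $N_1,\dots,N_r$ of $S(TM)^\perp\cap S(TM^\perp)^\perp$ with $\overline g(N_i,N_j)=0$ and $\overline g(\xi_i,N_j)=\delta_{ij}$ for a local frame $\xi_1,\dots,\xi_r$ of $\mathrm{Rad}\,TM$), so that $T\overline M|_M=TM\oplus S(TM^\perp)\oplus l\mathrm{tr}(TM)$. Let $\pi^s$ be the resulting projection onto $S(TM^\perp)$, and for $X\in\Gamma(TM)$, $W\in\Gamma(S(TM^\perp))$ put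 $\nabla^s_XW=\pi^s(\overline\nabla_XW)$. Suppose that $M$ is screen transversal anti-invariant: $\mathcal V\subset S(TM^\perp)$, and $J_a\mathrm{Rad}\,TM\subset S(TM^\perp)$, $J_aS(TM)\subset S(TM^\perp)$ for $a=1,2,3$. For each $a$ there is the decomposition $$S(TM^\perp)=\{J_a\mathrm{Rad}\,TM\oplus \pi^sJ_a\,l\mathrm{tr}(TM)\}\perp J_aS(TM)\perp D_0,$$ where $D_0$ is the orthogonal complement in $S(TM^\perp)$ of the other summands (and $\pi^sJ_a\,l\mathrm{tr}(TM)=J_a\,l\mathrm{tr}(TM)$ whenever $J_a\,l\mathrm{tr}(TM)\subset S(TM^\perp)$). **Theorem.** For each $a\in\{1,2,3\}$, the screen distribution $S(TM)$ is integrable (that is, $[X,Y]\in\Gamma(S(TM))$ for all $X,Y\in\Gamma(S(TM))$) if and only if, for all $X,Y\in\Gamma(S(TM))$, the field $$\nabla^s_XJ_aY-\nabla^s_YJ_aX$$ has no component in $J_a\mathrm{Rad}\,TM$ with respect to this decomposition (for $a=2,3$: on every $\mathcal O_i$, with the local tensors $G$, $H$ of $\mathcal O_i$). -/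

import Mathlib

open scoped Manifold ContDiff Topology Bundle

noncomputable section

namespace ComplexContact

/-! ### Complex manifolds as real manifolds -/

section Complex

variable {E : Type*} [NormedAddCommGroup E] [NormedSpace ℂ E]
variable {M : Type*} [TopologicalSpace M] [ChartedSpace E M]

/-- A complex manifold is a real manifold (with the same charts). -/
instance realManifold [IsManifold 𝓘(ℂ, E) ω M] : IsManifold 𝓘(ℝ, E) ω M := by
  refine isManifold_of_contDiffOn 𝓘(ℝ, E) ω M ?_
  intro e e' he he'
  have h := (contDiffGroupoid ω 𝓘(ℂ, E)).compatible he he'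
  rw [contDiffGroupoid, mem_groupoid_of_pregroupoid] at h
  exact h.1.restrict_scalars ℝ

/-- The almost complex structure `J` of a complex manifold: multiplication by the imaginary unit
in the tangent spaces. -/
def J (x : M) : TangentSpace 𝓘(ℝ, E) x →L[ℝ] TangentSpace 𝓘(ℝ, E) x :=
  (Complex.I • ContinuousLinearMap.id ℝ E : E →L[ℝ] E)

end Complex

/-! ### Exterior derivative and Nijenhuis tensor -/

section Tensors

variable {𝕜 : Type*} [RCLike 𝕜]
variable {E : Type*} [NormedAddCommGroup E] [NormedSpace 𝕜 E]
variable {M : Type*} [TopologicalSpace M] [ChartedSpace E M]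

/-- The derivative of the function `f` at `x` in the direction of the tangent vector `v`. -/
def dirDeriv (f : M → 𝕜) (x : M) (v : TangentSpace 𝓘(𝕜, E) x) : 𝕜 :=
  mfderiv 𝓘(𝕜, E) 𝓘(𝕜, 𝕜) f x v

/-- The exterior derivative of a 1-form, with the normalisation
`dα(X, Y) = 1/2 (X α(Y) - Y α(X) - α([X, Y]))` of contact metric geometry. -/
def extD (α : ∀ x : M, TangentSpace 𝓘(𝕜, E) x →L[𝕜] 𝕜)
    (X Y : ∀ x : M, TangentSpace 𝓘(𝕜, E) x) (x : M) : 𝕜 :=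
  (1 / 2) * (dirDeriv (fun y => α y (Y y)) x (X x) - dirDeriv (fun y => α y (X y)) x (Y x)
    - α x (VectorField.mlieBracket 𝓘(𝕜, E) X Y x))

/-- The vector field `X` is smooth (over `𝕜 = ℝ`), resp. holomorphic (over `𝕜 = ℂ`),
near the point `x`. -/
def SmoothNear [IsManifold 𝓘(𝕜, E) 1 M]
    (X : ∀ x : M, TangentSpace 𝓘(𝕜, E) x) (x : M) : Prop :=
  ∃ Ω : Set M, IsOpen Ω ∧ x ∈ Ω ∧
    ContMDiffOn 𝓘(𝕜, E) 𝓘(𝕜, E).tangent ∞ (fun y => (⟨y, X y⟩ : TangentBundle 𝓘(𝕜, E) M)) Ω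

/-- The Nijenhuis tensor `[A, A](X, Y) = A²[X, Y] + [AX, AY] - A[AX, Y] - A[X, AY]`. -/
def nijenhuis (A : ∀ x : M, TangentSpace 𝓘(𝕜, E) x →L[𝕜] TangentSpace 𝓘(𝕜, E) x)
    (X Y : ∀ x : M, TangentSpace 𝓘(𝕜, E) x) (x : M) : TangentSpace 𝓘(𝕜, E) x :=
  A x (A x (VectorField.mlieBracket 𝓘(𝕜, E) X Y x))
    + VectorField.mlieBracket 𝓘(𝕜, E) (fun y => A y (X y)) (fun y => A y (Y y)) x
    - A x (VectorField.mlieBracket 𝓘(𝕜, E) (fun y => A y (X y)) Y x)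
    - A x (VectorField.mlieBracket 𝓘(𝕜, E) X (fun y => A y (Y y)) x)

/-- The 1-form `α` is of class `C^k` on `Ω`. -/
def ContMDiffFormOn [IsManifold 𝓘(𝕜, E) 1 M] (k : WithTop ℕ∞)
    (α : ∀ x : M, TangentSpace 𝓘(𝕜, E) x →L[𝕜] 𝕜) (Ω : Set M) : Prop :=
  ContMDiffOn 𝓘(𝕜, E) (𝓘(𝕜, E).prod 𝓘(𝕜, E →L[𝕜] 𝕜)) k
    (fun x => Bundle.TotalSpace.mk' (E →L[𝕜] 𝕜)
      (E := fun x : M => TangentSpace 𝓘(𝕜, E) x →L[𝕜] 𝕜) x (α x)) Ω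

end Tensors

/-! ### Semi-Riemannian metrics and the Levi-Civita connection -/

section Metric

variable {E : Type*} [NormedAddCommGroup E] [NormedSpace ℝ E]
variable {M : Type*} [TopologicalSpace M] [ChartedSpace E M]

variable (E M) in
/-- A smooth semi-Riemannian metric: a smooth field of nondegenerate symmetric bilinear forms. -/
structure SemiRiemannianMetric [IsManifold 𝓘(ℝ, E) 1 M] where
  /-- the scalar product at a point -/
  val : ∀ x : M, TangentSpace 𝓘(ℝ, E) x →L[ℝ] TangentSpace 𝓘(ℝ, E) x →L[ℝ] ℝ
  symm : ∀ x X Y, val x X Y = val x Y X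
  nondegenerate : ∀ x X, (∀ Y, val x X Y = 0) → X = 0
  smooth : ContMDiff 𝓘(ℝ, E) (𝓘(ℝ, E).prod 𝓘(ℝ, E →L[ℝ] E →L[ℝ] ℝ)) ∞
    (fun x => Bundle.TotalSpace.mk' (E →L[ℝ] E →L[ℝ] ℝ)
      (E := fun x : M => TangentSpace 𝓘(ℝ, E) x →L[ℝ] TangentSpace 𝓘(ℝ, E) x →L[ℝ] ℝ) x (val x))

variable [IsManifold 𝓘(ℝ, E) 1 M] (g : SemiRiemannianMetric E M)

/-- The metric has constant index `ν`: at each point, `ν` is the largest dimension of a subspace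
on which the metric is negative definite. -/
def SemiRiemannianMetric.HasIndex (ν : ℕ) : Prop :=
  ∀ x : M, IsGreatest {k : ℕ | ∃ N : Submodule ℝ (TangentSpace 𝓘(ℝ, E) x),
    Module.finrank ℝ N = k ∧ ∀ X ∈ N, X ≠ 0 → g.val x X X < 0} ν

/-- The coefficients of the metric in the preferred chart around `x`:
the scalar product of the coordinate fields `a` and `b` at the point with coordinates `z`. -/
def SemiRiemannianMetric.inChart (x : M) (z a b : E) : ℝ :=
  g.val ((extChartAt 𝓘(ℝ, E) x).symm z)
    (mfderiv 𝓘(ℝ, E) 𝓘(ℝ, E) (extChartAt 𝓘(ℝ, E) x).symm z a)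
    (mfderiv 𝓘(ℝ, E) 𝓘(ℝ, E) (extChartAt 𝓘(ℝ, E) x).symm z b)

open Classical in
/-- The Christoffel symbol `Γ(a, b)` at `x` in the preferred chart around `x`: the vector with
`2 g(Γ(a, b), c) = ∂_a g(b, c) + ∂_b g(a, c) - ∂_c g(a, b)` for all `c`, which exists and is unique
in finite dimension because `g` is nondegenerate. (The tangent space at `x` is identified with `E`
through this chart.) -/
def SemiRiemannianMetric.christoffel (x : M) (a b : TangentSpace 𝓘(ℝ, E) x) :
    TangentSpace 𝓘(ℝ, E) x :=
  if h : ∃ w : TangentSpace 𝓘(ℝ, E) x, ∀ c : TangentSpace 𝓘(ℝ, E) x,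
      2 * g.val x w c =
        fderiv ℝ (fun z => g.inChart x z b c) (extChartAt 𝓘(ℝ, E) x x) a
        + fderiv ℝ (fun z => g.inChart x z a c) (extChartAt 𝓘(ℝ, E) x x) b
        - fderiv ℝ (fun z => g.inChart x z a b) (extChartAt 𝓘(ℝ, E) x x) c
  then h.choose else 0

variable {F : Type*} [NormedAddCommGroup F] [NormedSpace ℝ F]
variable {N : Type*} [TopologicalSpace N] [ChartedSpace F N] (f : N → M)

/-- The Levi-Civita connection of `g`, applied to a vector field `W` along a map `f` in the
direction of a tangent vector `X` of the source: in the preferred chart around `f p` it is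
`∂_X W + Γ(df X, W)`. -/
def SemiRiemannianMetric.covDeriv (W : ∀ p : N, TangentSpace 𝓘(ℝ, E) (f p)) (p : N)
    (X : TangentSpace 𝓘(ℝ, F) p) : TangentSpace 𝓘(ℝ, E) (f p) :=
  letI dW : E := mfderiv 𝓘(ℝ, F) 𝓘(ℝ, E)
    (fun q => (mfderiv 𝓘(ℝ, E) 𝓘(ℝ, E) (extChartAt 𝓘(ℝ, E) (f p)) (f q) (W q) : E)) p X
  letI Γ : E := g.christoffel (f p) (mfderiv 𝓘(ℝ, F) 𝓘(ℝ, E) f p X) (W p)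
  (dW + Γ : E)

/-- `s` is a smooth vector field along `f` on the set `Ω`. -/
def SmoothAlongOn (s : ∀ p : N, TangentSpace 𝓘(ℝ, E) (f p)) (Ω : Set N) : Prop :=
  ContMDiffOn 𝓘(ℝ, F) 𝓘(ℝ, E).tangent ∞
    (fun p => (⟨f p, s p⟩ : TangentBundle 𝓘(ℝ, E) M)) Ω

/-- `D` is a smooth subbundle of rank `k` of the pullback of the tangent bundle by `f`: locally it
has a smooth frame of `k` sections. For `f` the identity this is a smooth distribution. -/
def IsSmoothSubbundle (D : ∀ p : N, Submodule ℝ (TangentSpace 𝓘(ℝ, E) (f p))) (k : ℕ) : Prop :=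
  ∀ p₀ : N, ∃ (Ω : Set N) (s : Fin k → ∀ p : N, TangentSpace 𝓘(ℝ, E) (f p)),
    IsOpen Ω ∧ p₀ ∈ Ω ∧ (∀ j, SmoothAlongOn (F := F) f (s j) Ω) ∧
    ∀ p ∈ Ω, LinearIndependent ℝ (fun j => s j p) ∧
      Submodule.span ℝ (Set.range fun j => s j p) = D p

/-! ### Null submanifolds -/

/-- The tangent space of the submanifold, inside the tangent space of the ambient manifold. -/
def tangentImage (p : N) : Submodule ℝ (TangentSpace 𝓘(ℝ, E) (f p)) :=
  LinearMap.range (mfderiv 𝓘(ℝ, F) 𝓘(ℝ, E) f p).toLinearMap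

/-- The orthogonal complement of a subspace with respect to the metric. -/
def SemiRiemannianMetric.orth (x : M) (D : Submodule ℝ (TangentSpace 𝓘(ℝ, E) x)) :
    Submodule ℝ (TangentSpace 𝓘(ℝ, E) x) where
  carrier := {W | ∀ X ∈ D, g.val x W X = 0}
  add_mem' := by
    intro a b ha hb X hX
    simp only [Set.mem_ofPred_eq] at ha hb
    rw [map_add, add_apply, ha X hX, hb X hX, add_zero]
  zero_mem' := by
    intro X _
    simp
  smul_mem' := by
    intro c a ha X hX
    simp only [Set.mem_ofPred_eq] at ha
    rw [map_smul, smul_apply, ha X hX, smul_zero]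

/-- The image under `df` of a subspace of the tangent space of the submanifold. -/
def push (p : N) (D : Submodule ℝ (TangentSpace 𝓘(ℝ, F) p)) :
    Submodule ℝ (TangentSpace 𝓘(ℝ, E) (f p)) :=
  D.map (mfderiv 𝓘(ℝ, F) 𝓘(ℝ, E) f p).toLinearMap

/-- The radical `Rad T_pN`: the vectors of `T_pN` that are orthogonal to `T_pN`. -/
def radical (p : N) : Submodule ℝ (TangentSpace 𝓘(ℝ, F) p) :=
  (g.orth (f p) (tangentImage (F := F) f p)).comap (mfderiv 𝓘(ℝ, F) 𝓘(ℝ, E) f p).toLinearMap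

/-- `f : N → M` is an (immersed) `r`-null submanifold. -/
structure IsNullSubmanifold [IsManifold 𝓘(ℝ, F) 1 N] (r : ℕ) : Prop where
  smooth : ContMDiff 𝓘(ℝ, F) 𝓘(ℝ, E) ∞ f
  immersion : ∀ p, Function.Injective (mfderiv 𝓘(ℝ, F) 𝓘(ℝ, E) f p)
  pos : 0 < r
  radical_smooth : IsSmoothSubbundle (F := F) (fun p : N => p) (radical (F := F) g f) r

/-- A choice of screen distribution `S(TN)`, screen transversal bundle `S(TN^⊥)` and null
transversal bundle `ltr(TN)` on an `r`-null submanifold. -/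
structure ScreenData [IsManifold 𝓘(ℝ, F) 1 N] (r : ℕ) where
  /-- the screen distribution `S(TN)` -/
  S : ∀ p : N, Submodule ℝ (TangentSpace 𝓘(ℝ, F) p)
  /-- the screen transversal bundle `S(TN^⊥)` -/
  St : ∀ p : N, Submodule ℝ (TangentSpace 𝓘(ℝ, E) (f p))
  /-- the null transversal bundle `ltr(TN)` -/
  ltr : ∀ p : N, Submodule ℝ (TangentSpace 𝓘(ℝ, E) (f p))
  S_smooth : ∃ k, IsSmoothSubbundle (F := F) (fun p : N => p) S k
  S_compl : ∀ p, IsCompl (radical (F := F) g f p) (S p)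
  S_nondegenerate : ∀ p, push f p (S p) ⊓ g.orth (f p) (push f p (S p)) = ⊥
  St_smooth : ∃ k, IsSmoothSubbundle (F := F) f St k
  St_disjoint : ∀ p, Disjoint (push f p (radical (F := F) g f p)) (St p)
  St_sup : ∀ p, push f p (radical (F := F) g f p) ⊔ St p
    = g.orth (f p) (tangentImage (F := F) f p)
  St_nondegenerate : ∀ p, St p ⊓ g.orth (f p) (St p) = ⊥
  ltr_frame : ∀ p₀ : N, ∃ (Ω : Set N) (ξ : Fin r → ∀ p : N, TangentSpace 𝓘(ℝ, F) p)
    (η : Fin r → ∀ p : N, TangentSpace 𝓘(ℝ, E) (f p)),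
    IsOpen Ω ∧ p₀ ∈ Ω ∧
    (∀ j, SmoothAlongOn (F := F) (fun p : N => p) (ξ j) Ω) ∧
    (∀ j, SmoothAlongOn (F := F) f (η j) Ω) ∧
    ∀ p ∈ Ω,
      LinearIndependent ℝ (fun j => ξ j p) ∧
      Submodule.span ℝ (Set.range fun j => ξ j p) = radical (F := F) g f p ∧
      Submodule.span ℝ (Set.range fun j => η j p) = ltr p ∧
      (∀ j, η j p ∈ g.orth (f p) (push f p (S p)) ⊓ g.orth (f p) (St p)) ∧
      (∀ i j, g.val (f p) (η i p) (η j p) = 0) ∧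
      (∀ i j, g.val (f p) (mfderiv 𝓘(ℝ, F) 𝓘(ℝ, E) f p (ξ i p)) (η j p) = if i = j then 1 else 0)

variable {g f}

open Classical in
/-- The component of an ambient tangent vector in the screen transversal bundle, with respect to
the decomposition `TM = TN ⊕ S(TN^⊥) ⊕ ltr(TN)` along the submanifold. -/
def ScreenData.screenTransversalPart [IsManifold 𝓘(ℝ, F) 1 N] {r : ℕ}
    (D : ScreenData (F := F) g f r) (p : N) (w : TangentSpace 𝓘(ℝ, E) (f p)) :
    TangentSpace 𝓘(ℝ, E) (f p) :=
  if h : ∃ s ∈ D.St p, w - s ∈ tangentImage (F := F) f p ⊔ D.ltr p then h.choose else 0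

/-- The operator `∇^s_X W`: the screen transversal component of the ambient Levi-Civita derivative
of `W` in the direction of `X`. -/
def ScreenData.nablaS [IsManifold 𝓘(ℝ, F) 1 N] {r : ℕ} (D : ScreenData (F := F) g f r)
    (W : ∀ p : N, TangentSpace 𝓘(ℝ, E) (f p)) (p : N) (X : TangentSpace 𝓘(ℝ, F) p) :
    TangentSpace 𝓘(ℝ, E) (f p) :=
  D.screenTransversalPart p (g.covDeriv f W p X)

/-- `X` is a (global smooth) section of the distribution `S`. -/
def IsSection [IsManifold 𝓘(ℝ, F) 1 N] (S : ∀ p : N, Submodule ℝ (TangentSpace 𝓘(ℝ, F) p))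
    (X : ∀ p : N, TangentSpace 𝓘(ℝ, F) p) : Prop :=
  SmoothAlongOn (F := F) (fun p : N => p) X Set.univ ∧ ∀ p, X p ∈ S p

/-- A distribution is integrable if its sections are closed under the Lie bracket
(the bracket of smooth fields being smooth). -/
def IsIntegrable [IsManifold 𝓘(ℝ, F) 1 N]
    (S : ∀ p : N, Submodule ℝ (TangentSpace 𝓘(ℝ, F) p)) : Prop :=
  ∀ X Y, IsSection S X → IsSection S Y → ∀ p, VectorField.mlieBracket 𝓘(ℝ, F) X Y p ∈ S p

end Metric

/-! ### Complex contact metric manifolds -/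

section Contact

variable (n : ℕ) (ι : Type*) (E : Type*) [NormedAddCommGroup E] [NormedSpace ℂ E]
variable (M : Type*) [TopologicalSpace M] [ChartedSpace E M] [IsManifold 𝓘(ℂ, E) ω M]

/-- A complex contact structure on a complex manifold of complex dimension `2n + 1`: holomorphic
1-forms `θ_i` on the members of an open covering such that `θ_i ∧ (dθ_i)^n` vanishes nowhere, and
which are nowhere zero holomorphic multiples of each other on the overlaps. -/
structure ComplexContactStructure where
  /-- the members of the open covering -/
  O : ι → Set M
  isOpen_O : ∀ i, IsOpen (O i)
  cover : ∀ x, ∃ i, x ∈ O i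
  /-- the local contact forms -/
  θ : ι → ∀ x : M, TangentSpace 𝓘(ℂ, E) x →L[ℂ] ℂ
  θ_holomorphic : ∀ i, ContMDiffFormOn ω (θ i) (O i)
  /-- The value of `θ ∧ (dθ)^n` on some `2n + 1` vectors, up to a nonzero combinatorial factor,
  is nonzero. -/
  contact : ∀ i, ∀ x ∈ O i, ∃ e : Fin (2 * n + 1) → ∀ y : M, TangentSpace 𝓘(ℂ, E) y,
    (∀ k, SmoothNear (e k) x) ∧
    ∑ τ : Equiv.Perm (Fin (2 * n + 1)), ((Equiv.Perm.sign τ : ℤ) : ℂ) *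
      (θ i x (e (τ 0) x) * ∏ k : Fin n,
        extD (θ i) (e (τ ⟨2 * k + 1, by omega⟩)) (e (τ ⟨2 * k + 2, by omega⟩)) x) ≠ 0
  transition : ∀ i j, ∃ φ : M → ℂ, ContMDiffOn 𝓘(ℂ, E) 𝓘(ℂ, ℂ) ω φ (O i ∩ O j) ∧
    ∀ x ∈ O i ∩ O j, φ x ≠ 0 ∧ θ i x = φ x • θ j x

/-- The tensors of a complex almost contact metric structure that have to be specified: a metric
and local 1-forms `u_i`, vector fields `U_i`, endomorphism fields `G_i`, and the local 1-forms
`σ_i` of a complex contact metric structure. The remaining ones (`v_i`, `V_i`, `H_i`) are derived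
from these below. -/
structure ComplexContactTensors extends ComplexContactStructure n ι E M where
  /-- the semi-Riemannian metric -/
  g : SemiRiemannianMetric E M
  /-- the local 1-forms `u_i` -/
  u : ι → ∀ x : M, TangentSpace 𝓘(ℝ, E) x →L[ℝ] ℝ
  /-- the local vector fields `U_i` -/
  U : ι → ∀ x : M, TangentSpace 𝓘(ℝ, E) x
  /-- the local (1,1)-tensor fields `G_i` -/
  G : ι → ∀ x : M, TangentSpace 𝓘(ℝ, E) x →L[ℝ] TangentSpace 𝓘(ℝ, E) x
  /-- the local 1-forms `σ_i` -/
  σ : ι → ∀ x : M, TangentSpace 𝓘(ℝ, E) x →L[ℝ] ℝ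
  u_smooth : ∀ i, ContMDiffFormOn ∞ (u i) (O i)
  U_smooth : ∀ i, ContMDiffOn 𝓘(ℝ, E) 𝓘(ℝ, E).tangent ∞
    (fun x => (⟨x, U i x⟩ : TangentBundle 𝓘(ℝ, E) M)) (O i)
  G_smooth : ∀ i, ContMDiffOn 𝓘(ℝ, E) (𝓘(ℝ, E).prod 𝓘(ℝ, E →L[ℝ] E)) ∞
    (fun x => Bundle.TotalSpace.mk' (E →L[ℝ] E)
      (E := fun x : M => TangentSpace 𝓘(ℝ, E) x →L[ℝ] TangentSpace 𝓘(ℝ, E) x) x (G i x)) (O i)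
  σ_smooth : ∀ i, ContMDiffFormOn ∞ (σ i) (O i)

variable {n ι E M}

namespace ComplexContactTensors

variable (C : ComplexContactTensors n ι E M)

/-- `v_i = u_i ∘ J`. -/
def v (i : ι) (x : M) : TangentSpace 𝓘(ℝ, E) x →L[ℝ] ℝ := (C.u i x).comp (J x)

/-- `V_i = -J U_i`. -/
def V (i : ι) (x : M) : TangentSpace 𝓘(ℝ, E) x := - J x (C.U i x)

/-- `H_i = G_i J`. -/
def H (i : ι) (x : M) : TangentSpace 𝓘(ℝ, E) x →L[ℝ] TangentSpace 𝓘(ℝ, E) x :=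
  (C.G i x).comp (J x)

/-- The three tensors `J_1 = J`, `J_2 = G`, `J_3 = H` (indexed by `0, 1, 2`). -/
def Ja (a : Fin 3) (i : ι) (x : M) : TangentSpace 𝓘(ℝ, E) x →L[ℝ] TangentSpace 𝓘(ℝ, E) x :=
  ![J x, C.G i x, C.H i x] a

/-- The wedge product `σ ∧ α` with the normalisation
`(σ ∧ α)(X, Y) = 1/2 (σ(X) α(Y) - σ(Y) α(X))` that goes with that of `extD`. -/
def wedge {x : M} (s α : TangentSpace 𝓘(ℝ, E) x →L[ℝ] ℝ) (X Y : TangentSpace 𝓘(ℝ, E) x) : ℝ :=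
  (1 / 2) * (s X * α Y - s Y * α X)

/-- A complex almost contact metric structure: the metric is Hermitian and the local tensors
satisfy the algebraic conditions and the transition rules. -/
structure IsAlmostContactMetric : Prop where
  hermitian : ∀ x X Y, C.g.val x (J x X) (J x Y) = C.g.val x X Y
  G_sq : ∀ i, ∀ x ∈ C.O i, ∀ X,
    C.G i x (C.G i x X) = - X + C.u i x X • C.U i x + C.v i x X • C.V i x
  H_sq : ∀ i, ∀ x ∈ C.O i, ∀ X,
    C.H i x (C.H i x X) = - X + C.u i x X • C.U i x + C.v i x X • C.V i x
  G_skew : ∀ i, ∀ x ∈ C.O i, ∀ X Y, C.g.val x (C.G i x X) Y = - C.g.val x X (C.G i x Y)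
  U_dual : ∀ i, ∀ x ∈ C.O i, ∀ X, C.g.val x (C.U i x) X = C.u i x X
  G_J : ∀ i, ∀ x ∈ C.O i, ∀ X, C.G i x (J x X) = - J x (C.G i x X)
  G_U : ∀ i, ∀ x ∈ C.O i, C.G i x (C.U i x) = 0
  u_U : ∀ i, ∀ x ∈ C.O i, C.u i x (C.U i x) = 1
  overlap : ∀ i j, ∃ a b : M → ℝ, ∀ x ∈ C.O i ∩ C.O j,
    a x ^ 2 + b x ^ 2 = 1 ∧
    C.u j x = a x • C.u i x - b x • C.v i x ∧
    C.v j x = b x • C.u i x + a x • C.v i x ∧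
    C.G j x = a x • C.G i x - b x • C.H i x ∧
    C.H j x = b x • C.G i x + a x • C.H i x

/-- An (indefinite) complex contact metric structure: a complex almost contact metric structure in
which `u - i v` is a nowhere zero multiple of the local contact form, with
`du(X, Y) = g(X, GY) + (σ ∧ v)(X, Y)` and `dv(X, Y) = g(X, HY) - (σ ∧ u)(X, Y)`. -/
structure IsContactMetric : Prop extends C.IsAlmostContactMetric where
  θ_eq : ∀ i, ∀ x ∈ C.O i, ∃ φ : ℂ, φ ≠ 0 ∧ ∀ X : E,
    C.θ i x X = φ * (((C.u i x X : ℝ) : ℂ) - Complex.I * ((C.v i x X : ℝ) : ℂ))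
  du : ∀ i, ∀ x ∈ C.O i, ∀ X Y, SmoothNear X x → SmoothNear Y x →
    extD (C.u i) X Y x
      = C.g.val x (X x) (C.G i x (Y x)) + wedge (C.σ i x) (C.v i x) (X x) (Y x)
  dv : ∀ i, ∀ x ∈ C.O i, ∀ X Y, SmoothNear X x → SmoothNear Y x →
    extD (C.v i) X Y x
      = C.g.val x (X x) (C.H i x (Y x)) - wedge (C.σ i x) (C.u i x) (X x) (Y x)

/-- The tensor `S` of the definition of normality. -/
def tensorS (i : ι) (X Y : ∀ x : M, TangentSpace 𝓘(ℝ, E) x) (x : M) : TangentSpace 𝓘(ℝ, E) x :=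
  nijenhuis (C.G i) X Y x
    + (2 * C.g.val x (X x) (C.G i x (Y x))) • C.U i x
    - (2 * C.g.val x (X x) (C.H i x (Y x))) • C.V i x
    + (2 : ℝ) • (C.v i x (Y x) • C.H i x (X x) - C.v i x (X x) • C.H i x (Y x))
    + C.σ i x (C.G i x (Y x)) • C.H i x (X x) - C.σ i x (C.G i x (X x)) • C.H i x (Y x)
    + C.σ i x (X x) • C.G i x (C.H i x (Y x)) - C.σ i x (Y x) • C.G i x (C.H i x (X x))

/-- The tensor `T` of the definition of normality. -/
def tensorT (i : ι) (X Y : ∀ x : M, TangentSpace 𝓘(ℝ, E) x) (x : M) : TangentSpace 𝓘(ℝ, E) x :=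
  nijenhuis (C.H i) X Y x
    - (2 * C.g.val x (X x) (C.G i x (Y x))) • C.U i x
    + (2 * C.g.val x (X x) (C.H i x (Y x))) • C.V i x
    + (2 : ℝ) • (C.u i x (Y x) • C.G i x (X x) - C.u i x (X x) • C.G i x (Y x))
    + C.σ i x (C.H i x (X x)) • C.G i x (Y x) - C.σ i x (C.H i x (Y x)) • C.G i x (X x)
    + C.σ i x (X x) • C.G i x (C.H i x (Y x)) - C.σ i x (Y x) • C.G i x (C.H i x (X x))

/-- The vector `X` belongs to the horizontal subbundle (the kernel of the contact form, that is,
of `u` and `v`). -/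
def IsHorizontal (i : ι) (x : M) (X : TangentSpace 𝓘(ℝ, E) x) : Prop :=
  C.u i x X = 0 ∧ C.v i x X = 0

/-- Normality: `S(X, Y) = T(X, Y) = 0` for horizontal `X, Y`, and `S(U, X) = T(V, X) = 0` for
all `X`. (`S` and `T` are tensors: only the values of the fields at the point matter.) -/
structure IsNormal : Prop where
  horizontal : ∀ i, ∀ x ∈ C.O i, ∀ X Y, SmoothNear X x → SmoothNear Y x →
    C.IsHorizontal i x (X x) → C.IsHorizontal i x (Y x) →
    C.tensorS i X Y x = 0 ∧ C.tensorT i X Y x = 0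
  vertical : ∀ i, ∀ x ∈ C.O i, ∀ X, SmoothNear X x →
    C.tensorS i (C.U i) X x = 0 ∧ C.tensorT i (C.V i) X x = 0

/-! ### Screen transversal anti-invariant null submanifolds -/

variable {F : Type*} [NormedAddCommGroup F] [NormedSpace ℝ F]
variable {N : Type*} [TopologicalSpace N] [ChartedSpace F N] [IsManifold 𝓘(ℝ, F) 1 N]
variable {f : N → M} {r : ℕ} (D : ScreenData (F := F) C.g f r)

/-- The null submanifold is screen transversal anti-invariant: the vertical subbundle, `J_a Rad TN`
and `J_a S(TN)` are contained in `S(TN^⊥)`, for `a = 1, 2, 3`. -/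
structure IsScreenTransversalAntiInvariant : Prop where
  vertical : ∀ i p, f p ∈ C.O i → C.U i (f p) ∈ D.St p ∧ C.V i (f p) ∈ D.St p
  radical : ∀ a i p, f p ∈ C.O i →
    (push f p (radical (F := F) C.g f p)).map (C.Ja a i (f p)).toLinearMap ≤ D.St p
  screen : ∀ a i p, f p ∈ C.O i →
    (push f p (D.S p)).map (C.Ja a i (f p)).toLinearMap ≤ D.St p

/-- The vector field `J_a X` along the submanifold, for a tangent vector field `X`. -/
def JaField (f : N → M) (a : Fin 3) (i : ι) (X : ∀ p : N, TangentSpace 𝓘(ℝ, F) p) (p : N) :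
    TangentSpace 𝓘(ℝ, E) (f p) :=
  C.Ja a i (f p) (mfderiv 𝓘(ℝ, F) 𝓘(ℝ, E) f p (X p))

/-- The subspace of the screen transversal parts of the vectors of `J_a ltr(TN)`. It equals
`J_a ltr(TN)` whenever this is contained in `S(TN^⊥)`. -/
def JaLtr (a : Fin 3) (i : ι) (p : N) : Set (TangentSpace 𝓘(ℝ, E) (f p)) :=
  {w | ∃ η ∈ D.ltr p, w = D.screenTransversalPart p (C.Ja a i (f p) η)}

/-- The subbundle `D₀`: the vectors of `S(TN^⊥)` that are orthogonal to `J_a Rad TN`,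
`J_a ltr(TN)` and `J_a S(TN)`. -/
def dZero (a : Fin 3) (i : ι) (p : N) : Set (TangentSpace 𝓘(ℝ, E) (f p)) :=
  {w | w ∈ D.St p ∧
    (∀ ξ ∈ radical (F := F) C.g f p,
      C.g.val (f p) w (C.Ja a i (f p) (mfderiv 𝓘(ℝ, F) 𝓘(ℝ, E) f p ξ)) = 0) ∧
    (∀ η ∈ C.JaLtr D a i p, C.g.val (f p) w η = 0) ∧
    (∀ Z ∈ D.S p, C.g.val (f p) w (C.Ja a i (f p) (mfderiv 𝓘(ℝ, F) 𝓘(ℝ, E) f p Z)) = 0)}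

/-- A screen transversal vector `w` has no component in `J_a Rad TN`, with respect to the
decomposition `S(TN^⊥) = {J_a Rad TN ⊕ J_a ltr(TN)} ⊥ J_a S(TN) ⊥ D₀`: it is a sum of vectors of
the other three summands. -/
def NoComponentInJaRad (a : Fin 3) (i : ι) (p : N) (w : TangentSpace 𝓘(ℝ, E) (f p)) : Prop :=
  ∃ η ∈ C.JaLtr D a i p, ∃ Z ∈ D.S p, ∃ d ∈ C.dZero D a i p,
    w = η + C.Ja a i (f p) (mfderiv 𝓘(ℝ, F) 𝓘(ℝ, E) f p Z) + d

end ComplexContactTensors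

end Contact

end ComplexContact

end

/-!
At a point `x = f p` let `hor = ker u ∩ ker v`. Contact metric geometry gives the covariant
derivatives of the structure tensors on horizontal vectors:
`g((∇_a G) b, c) = σ(a) g(H b, c)`, `g((∇_a H) b, c) = -σ(a) g(G b, c)` and `g((∇_a J) b, c) = 0`
(`bilinRep_nabla_G`, `bilinRep_nabla_H`, `bilinRep_nabla_J`). The first two are instances of
`bilinRep_nabla`. The trilinear form `A(a, b, c) = g((∇_a G) b, c) - σ(a) g(H b, c)` is
skew-symmetric in `b, c` and satisfies `A(a, G b, c) = A(a, b, G c)`, because `G` is skew with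
square `-1` on `hor`; its cyclic sum vanishes because `d(du) = 0`; and normality says that a
Nijenhuis type combination of `A` vanishes. As in the proof that a Hermitian structure with closed
fundamental form is Kähler, these conditions force `A = 0` (`eq_zero_of_cyclic_of_nijenhuis`). The formula for `∇J`
follows from the other two, as `H = G J`.

Because the connection is torsion-free, for sections `X`, `Y` of the screen distribution
`∇_X J_a Y - ∇_Y J_a X = J_a [X, Y] + (∇_X J_a) Y - (∇_Y J_a) X`
(`covDeriv_endomorphism_sub`). The tangent space `TN` and `ltr(TN)` are horizontal, and
`J_1`, `J_2`, `J_3` multiply like quaternion units up to sign, so the last two terms are orthogonal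
to `J_a TN` and `J_a ltr(TN)`: the projection of their difference to `S(TN^⊥)` lies in `D₀`
(`nablaS_sub`). Hence
`∇^s_X J_a Y - ∇^s_Y J_a X` is `J_a [X, Y]` up to a vector of `D₀`, and its component in
`J_a Rad TN` is `J_a` of the radical part of `[X, Y]`. As `J_a` is an isometry on horizontal vectors
and `Rad TN` is dual to `ltr(TN)`, it vanishes exactly if `[X, Y]` is in the screen distribution
(`noComponentInJaRad_iff`).

All computations at a point take place in the preferred chart around that point. This is the chart
in which the Christoffel symbols are defined, and the coordinate fields `frameL x · a` extend
tangent vectors to smooth fields that can be inserted into the equations for `du`, `dv`, `S`, `T`.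
-/

noncomputable section

namespace ComplexContact

/-! ### The covariant derivatives of the structure tensors, algebraically -/

section Algebra

/-- The algebra behind an almost Hermitian structure with closed fundamental form and vanishing
Nijenhuis tensor is parallel, on a set `h` of vectors where `K² = -1`; `A(a, b, c)` stands for
`g((∇_a K) b, c)`, up to a correction. -/
theorem eq_zero_of_cyclic_of_nijenhuis {V : Type*} [AddCommGroup V] {h : Set V} {K : V → V}
    {A : V → V → V → ℝ} (hK : ∀ a ∈ h, K a ∈ h) (hKK : ∀ a ∈ h, K (K a) = -a)
    (neg : ∀ a b c, A a b (-c) = -A a b c)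
    (skew : ∀ a ∈ h, ∀ b ∈ h, ∀ c ∈ h, A a b c = -A a c b)
    (comm : ∀ a ∈ h, ∀ b ∈ h, ∀ c ∈ h, A a (K b) c = A a b (K c))
    (cyc : ∀ a ∈ h, ∀ b ∈ h, ∀ c ∈ h, A a b c + A b c a + A c a b = 0)
    (nij : ∀ a ∈ h, ∀ b ∈ h, ∀ c ∈ h,
      A (K a) b c - A (K b) a c + A a b (K c) - A b a (K c) = 0)
    {a b c : V} (ha : a ∈ h) (hb : b ∈ h) (hc : c ∈ h) : A a b c = 0 := by
  -- The Nijenhuis condition at `(b, c, K a)`, the cyclic one at `(a, K b, K c)` and `(a, b, c)`.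
  have h1 := nij b hb c hc (K a) (hK a ha)
  rw [hKK a ha, neg, neg] at h1
  have h2 := cyc a ha (K b) (hK b hb) (K c) (hK c hc)
  rw [comm a ha b hb _ (hK c hc), hKK c hc, neg, comm _ (hK b hb) c hc a ha,
    skew _ (hK c hc) a ha _ (hK b hb), comm _ (hK c hc) b hb a ha] at h2
  have h3 := cyc a ha b hb c hc
  have h4 := skew c hc a ha b hb
  linarith

/-- The covariant derivative `∇_a K` of an endomorphism field `K` in coordinates: `K` and its
coordinate derivative `DK`, and the Christoffel symbol `Γ`, at the given point. -/
def nablaEnd {V : Type*} [NormedAddCommGroup V] [NormedSpace ℝ V] (Γ : V → V → V) (K : V →L[ℝ] V)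
    (DK : V →L[ℝ] V →L[ℝ] V) (a b : V) : V :=
  DK a b + Γ a (K b) - K (Γ a b)

variable {V : Type*} [NormedAddCommGroup V] [NormedSpace ℝ V]

/-- The formula `g((∇_a K) b, c) = ε σ(a) g(L b, c)` on the horizontal subspace `h`, from relations
between the values and coordinate derivatives `Dg`, `DK` of the metric and of `K` at a point: `hDg`
is metricity of the connection, `DKskew` and `DKsq` are the derivatives of skew-symmetry and of
`K² = -1`, `closed` is `d(dκ) = 0` for the contact form `κ` of `K`, and `nij` is normality. -/
theorem nablaEnd_of_normal {h : Submodule ℝ V} {g : V →L[ℝ] V →L[ℝ] ℝ}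
    (gs : ∀ a b, g a b = g b a) {Γ : V → V → V} (Γs : ∀ a b, Γ a b = Γ b a)
    {Dg : V →L[ℝ] V →L[ℝ] V →L[ℝ] ℝ}
    (hDg : ∀ a b c, Dg a b c = g (Γ a b) c + g b (Γ a c))
    {K L : V →L[ℝ] V} {DK : V →L[ℝ] V →L[ℝ] V} {σ : V → ℝ} {ε : ℝ}
    (hK : ∀ a ∈ h, K a ∈ h)
    (hKK : ∀ a ∈ h, K (K a) = -a)
    (hKK' : ∀ a, ∀ c ∈ h, g (K (K a)) c = -g a c)
    (skK : ∀ a b, g (K a) b = -g a (K b)) (skL : ∀ a b, g (L a) b = -g a (L b))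
    (LK : ∀ a ∈ h, L (K a) = -K (L a))
    (DKskew : ∀ a b c, Dg a (K b) c + g (DK a b) c + Dg a b (K c) + g b (DK a c) = 0)
    (DKsq : ∀ a, ∀ b ∈ h, ∀ c ∈ h, g (DK a (K b)) c + g (K (DK a b)) c = 0)
    (closed : ∀ a ∈ h, ∀ b ∈ h, ∀ c ∈ h,
      (Dg c a (K b) + g a (DK c b)) + (Dg a b (K c) + g b (DK a c))
        + (Dg b c (K a) + g c (DK b a))
        + ε * (σ a * g c (L b) + σ b * g a (L c) + σ c * g b (L a)) = 0)
    (nij : ∀ a ∈ h, ∀ b ∈ h, ∀ c ∈ h,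
      g (DK (K a) b - DK (K b) a + K (DK b a) - K (DK a b)) c
        + ε * (σ (K b) * g (L a) c - σ (K a) * g (L b) c
          + σ a * g (K (L b)) c - σ b * g (K (L a)) c) = 0)
    {a b c : V} (ha : a ∈ h) (hb : b ∈ h) (hc : c ∈ h) :
    g (nablaEnd Γ K DK a b) c = ε * (σ a * g (L b) c) := by
  have skew (a b c : V) : g (nablaEnd Γ K DK a b) c = -g (nablaEnd Γ K DK a c) b := by
    have h1 := DKskew a b c
    rw [hDg, hDg] at h1
    simp only [nablaEnd, map_add, map_sub, add_apply, sub_apply, skK] at h1 ⊢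
    rw [gs (Γ a (K c)) b, gs (Γ a c) (K b), skK b, gs (DK a c) b]
    linarith
  have skewL (a b : V) : g (L a) b = -g (L b) a := by rw [skL, gs]
  suffices g (nablaEnd Γ K DK a b) c - ε * (σ a * g (L b) c) = 0 by linarith
  refine eq_zero_of_cyclic_of_nijenhuis (h := (h : Set V)) (K := K)
    (A := fun a b c => g (nablaEnd Γ K DK a b) c - ε * (σ a * g (L b) c)) hK hKK
    (fun a b c => ?_) (fun a _ b _ c _ => ?_) (fun a ha b hb c hc => ?_)
    (fun a ha b hb c hc => ?_) (fun a ha b hb c hc => ?_) ha hb hc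
  · simp only [map_neg]
    ring
  · rw [skew, skewL b c]
    ring
  · have h1 := DKsq a b hb c hc
    have h2 := hKK' (Γ a b) c hc
    have h3 := hDg a (-b) c
    have h4 := hDg a b c
    have h5 := skK (Γ a (K b)) c
    simp only [nablaEnd, map_add, map_sub, map_neg, neg_apply, add_apply, sub_apply, skK,
      hKK b hb, LK b hb] at h1 h2 h3 h4 h5 ⊢
    linarith
  · have h1 := closed a ha b hb c hc
    rw [hDg, hDg, hDg] at h1
    simp only [nablaEnd, map_add, map_sub, add_apply, sub_apply, skK]
    have s1 := skew a b c
    have s2 := skew b c a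
    have s3 := skew c a b
    simp only [nablaEnd, map_add, map_sub, add_apply, sub_apply, skK] at s1 s2 s3
    rw [skL a b, skL b c, skL c a]
    rw [gs a (Γ c (K b)), gs b (Γ a (K c)), gs c (Γ b (K a)), gs a (DK c b), gs b (DK a c),
      gs c (DK b a), gs c (L b), skL b c, gs b (L a), skL a b,
      gs a (L c), skL c a] at h1
    simp only [Γs c a, Γs c b, Γs b a] at h1 s1 s2 s3 ⊢
    linarith
  · have h1 := nij a ha b hb c hc
    simp only [nablaEnd, map_add, map_sub, add_apply, sub_apply, skK] at h1 ⊢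
    rw [Γs (K a) b, Γs (K b) a, Γs (K b) (K a), Γs b a]
    linarith

/-- The product rule for `∇ (K J)`, where `J` is constant in coordinates. -/
theorem nablaEnd_comp (Γ : V → V → V) (K J : V →L[ℝ] V) (DK : V →L[ℝ] V →L[ℝ] V) (a b : V) :
    nablaEnd Γ (K.comp J) ((ContinuousLinearMap.precomp V J).comp DK) a b
      = nablaEnd Γ K DK a (J b) + K (nablaEnd Γ J 0 a b) := by
  simp [nablaEnd]

/-- If `∇K = σ ⊗ K J` and `∇(K J) = -σ ⊗ K` on the horizontal subspace `h`, then `∇J = 0` there. -/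
theorem nablaEnd_eq_zero_of_comp {h : Submodule ℝ V} {g : V →L[ℝ] V →L[ℝ] ℝ} {Γ : V → V → V}
    {K J : V →L[ℝ] V} {DK : V →L[ℝ] V →L[ℝ] V} {σ : V → ℝ}
    (hK : ∀ a ∈ h, K a ∈ h) (hJ : ∀ a ∈ h, J a ∈ h)
    (hKK : ∀ a ∈ h, K (K a) = -a) (hJJ : ∀ a, J (J a) = -a)
    (skK : ∀ a b, g (K a) b = -g a (K b))
    (h1 : ∀ a ∈ h, ∀ b ∈ h, ∀ c ∈ h,
      g (nablaEnd Γ K DK a b) c = σ a * g (K (J b)) c)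
    (h2 : ∀ a ∈ h, ∀ b ∈ h, ∀ c ∈ h,
      g (nablaEnd Γ (K.comp J) ((ContinuousLinearMap.precomp V J).comp DK) a b) c
        = -(σ a * g (K b) c))
    {a b c : V} (ha : a ∈ h) (hb : b ∈ h) (hc : c ∈ h) :
    g (nablaEnd Γ J 0 a b) c = 0 := by
  have e1 := h1 a ha (J b) (hJ b hb) (K c) (hK c hc)
  have e2 := h2 a ha b hb (K c) (hK c hc)
  simp only [nablaEnd_comp, map_add, add_apply, e1, hJJ, map_neg, neg_apply, skK, hKK c hc] at e2
  linarith

end Algebra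

/-! ### Tensor fields in a chart -/

section ChartFields

variable {E : Type*} [NormedAddCommGroup E] [NormedSpace ℝ E]
variable {M : Type*} [TopologicalSpace M] [ChartedSpace E M] [IsManifold 𝓘(ℝ, E) ∞ M]

/-- The coordinates of tangent vectors at `y`, in the preferred chart around `x`. -/
def coordL (x y : M) : TangentSpace 𝓘(ℝ, E) y →L[ℝ] E :=
  (trivializationAt E (TangentSpace 𝓘(ℝ, E)) x).continuousLinearMapAt ℝ y

/-- The tangent vector at `y` with given coordinates in the preferred chart around `x`. For fixed
coordinates and variable `y` this is a constant linear combination of the coordinate fields. -/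
def frameL (x y : M) : E →L[ℝ] TangentSpace 𝓘(ℝ, E) y :=
  (trivializationAt E (TangentSpace 𝓘(ℝ, E)) x).symmL ℝ y

theorem coordL_frameL {x y : M} (hy : y ∈ (chartAt E x).source) (a : E) :
    coordL x y (frameL x y a) = a :=
  (trivializationAt E (TangentSpace 𝓘(ℝ, E)) x).continuousLinearMapAt_symmL
    (by simpa using hy) a

theorem frameL_coordL {x y : M} (hy : y ∈ (chartAt E x).source) (v : TangentSpace 𝓘(ℝ, E) y) :
    frameL x y (coordL x y v) = v :=
  (trivializationAt E (TangentSpace 𝓘(ℝ, E)) x).symmL_continuousLinearMapAt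
    (by simpa using hy) v

theorem coordL_eq_mfderiv {x y : M} (hy : y ∈ (chartAt E x).source) :
    coordL x y = mfderiv 𝓘(ℝ, E) 𝓘(ℝ, E) (extChartAt 𝓘(ℝ, E) x) y :=
  TangentBundle.continuousLinearMapAt_trivializationAt hy

theorem coordL_self (x : M) (v : TangentSpace 𝓘(ℝ, E) x) : coordL x x v = v := by
  have h : coordL x x = (tangentBundleCore 𝓘(ℝ, E) M).coordChange (achart E x) (achart E x) x :=
    TangentBundle.continuousLinearMapAt_trivializationAt_eq_core (mem_chart_source E x)
  rw [h]
  exact (tangentBundleCore 𝓘(ℝ, E) M).coordChange_self (achart E x) x (mem_chart_source E x) v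

theorem frameL_self (x : M) (a : E) : frameL x x a = a := by
  have h := coordL_frameL (mem_chart_source E x) a
  rwa [coordL_self] at h

/-- The coordinate fields of the preferred chart around `x` are the fields `frameL x · a`. -/
theorem mfderiv_symm_eq_frameL {x : M} {z : E} (hz : z ∈ (extChartAt 𝓘(ℝ, E) x).target) (a : E) :
    mfderiv 𝓘(ℝ, E) 𝓘(ℝ, E) (extChartAt 𝓘(ℝ, E) x).symm z a
      = frameL x ((extChartAt 𝓘(ℝ, E) x).symm z) a := by
  have hy : (extChartAt 𝓘(ℝ, E) x).symm z ∈ (chartAt E x).source := by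
    simpa using (extChartAt 𝓘(ℝ, E) x).map_target hz
  have h := mfderiv_extChartAt_comp_mfderivWithin_extChartAt_symm (I := 𝓘(ℝ, E)) hz
  rw [← coordL_eq_mfderiv hy, ModelWithCorners.range_eq_univ, mfderivWithin_univ] at h
  rw [← frameL_coordL hy (mfderiv 𝓘(ℝ, E) 𝓘(ℝ, E) (extChartAt 𝓘(ℝ, E) x).symm z a)]
  exact congrArg (frameL x _) (DFunLike.congr_fun h a)

/-- An endomorphism field in the preferred chart around `x`, at the point `y`. -/
def endRep (x : M) (K : ∀ y : M, TangentSpace 𝓘(ℝ, E) y →L[ℝ] TangentSpace 𝓘(ℝ, E) y) (y : M) :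
    E →L[ℝ] E :=
  (coordL x y).comp ((K y).comp (frameL x y))

/-- A 1-form in the preferred chart around `x`, at the point `y`. -/
def formRep (x : M) (α : ∀ y : M, TangentSpace 𝓘(ℝ, E) y →L[ℝ] ℝ) (y : M) : E →L[ℝ] ℝ :=
  (α y).comp (frameL x y)

/-- A field of bilinear forms in the preferred chart around `x`, at the point `y`. -/
def bilinRep (x : M) (b : ∀ y : M, TangentSpace 𝓘(ℝ, E) y →L[ℝ] TangentSpace 𝓘(ℝ, E) y →L[ℝ] ℝ)
    (y : M) : E →L[ℝ] E →L[ℝ] ℝ :=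
  (ContinuousLinearMap.precomp ℝ (frameL x y)).comp ((b y).comp (frameL x y))

theorem contMDiffAt_formRep {k : ℕ∞} {α : ∀ y : M, TangentSpace 𝓘(ℝ, E) y →L[ℝ] ℝ} {x : M}
    {Ω : Set M} (hΩ : IsOpen Ω) (hx : x ∈ Ω) (h : ContMDiffFormOn k α Ω) :
    ContMDiffAt 𝓘(ℝ, E) 𝓘(ℝ, E →L[ℝ] ℝ) k (formRep x α) x := by
  have h1 := (h.contMDiffAt (hΩ.mem_nhds hx))
  have h2 := ((contMDiffAt_hom_bundle (E₂ := Bundle.Trivial M ℝ) _).1 h1).2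
  refine h2.congr_of_eventuallyEq (.of_forall fun y => ?_)
  ext a
  simp [formRep, frameL, ContinuousLinearMap.inCoordinates]

theorem contMDiffAt_endRep {k : ℕ∞}
    {K : ∀ y : M, TangentSpace 𝓘(ℝ, E) y →L[ℝ] TangentSpace 𝓘(ℝ, E) y} {x : M} {Ω : Set M}
    (hΩ : IsOpen Ω) (hx : x ∈ Ω)
    (h : ContMDiffOn 𝓘(ℝ, E) (𝓘(ℝ, E).prod 𝓘(ℝ, E →L[ℝ] E)) k
    (fun x => Bundle.TotalSpace.mk' (E →L[ℝ] E)
      (E := fun x : M => TangentSpace 𝓘(ℝ, E) x →L[ℝ] TangentSpace 𝓘(ℝ, E) x) x (K x)) Ω) :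
    ContMDiffAt 𝓘(ℝ, E) 𝓘(ℝ, E →L[ℝ] E) k (endRep x K) x :=
  ((contMDiffAt_hom_bundle _).1 (h.contMDiffAt (hΩ.mem_nhds hx))).2

theorem contMDiffAt_bilinRep (g : SemiRiemannianMetric E M) (x : M) :
    ContMDiffAt 𝓘(ℝ, E) 𝓘(ℝ, E →L[ℝ] E →L[ℝ] ℝ) ∞ (bilinRep x g.val) x := by
  have h2 := ((contMDiffAt_hom_bundle
    (E₂ := fun x : M => TangentSpace 𝓘(ℝ, E) x →L[ℝ] Bundle.Trivial M ℝ x) _).1 (g.smooth x)).2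
  refine h2.congr_of_eventuallyEq ?_
  filter_upwards [(chartAt E x).open_source.mem_nhds (mem_chart_source E x)] with y hy
  ext a b
  have hy' : y ∈ (trivializationAt (E →L[ℝ] ℝ)
      (fun x : M => TangentSpace 𝓘(ℝ, E) x →L[ℝ] Bundle.Trivial M ℝ x) x).baseSet := by
    simpa using hy
  rw [ContinuousLinearMap.inCoordinates]
  simp only [ContinuousLinearMap.comp_apply, Bundle.Trivialization.continuousLinearMapAt_apply,
    Bundle.Trivialization.linearMapAt_apply, hy', if_true]
  rw [hom_trivializationAt_apply]
  simp [bilinRep, frameL, ContinuousLinearMap.inCoordinates]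

end ChartFields

/-! ### Derivatives and Lie brackets in a chart -/

section ChartBracket

theorem two_le_infty : (2 : WithTop ℕ∞) ≤ ∞ :=
  (WithTop.coe_le_coe.2 le_top : ((2 : ℕ∞) : WithTop ℕ∞) ≤ ∞)

variable {E : Type*} [NormedAddCommGroup E] [NormedSpace ℝ E]
variable {M : Type*} [TopologicalSpace M] [ChartedSpace E M]
variable {W : Type*} [NormedAddCommGroup W] [NormedSpace ℝ W]

theorem contDiffAt_comp_symm {R : M → W} {x : M} {k : WithTop ℕ∞}
    (h : ContMDiffAt 𝓘(ℝ, E) 𝓘(ℝ, W) k R x) :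
    ContDiffAt ℝ k (R ∘ (extChartAt 𝓘(ℝ, E) x).symm) (extChartAt 𝓘(ℝ, E) x x) := by
  have h2 := (contMDiffAt_iff.1 h).2
  rwa [ModelWithCorners.range_eq_univ, contDiffWithinAt_univ] at h2

variable [IsManifold 𝓘(ℝ, E) ∞ M]

theorem dirDeriv_frameL {R : M → ℝ} {x y : M} (hy : y ∈ (chartAt E x).source)
    (h : DifferentiableAt ℝ (R ∘ (extChartAt 𝓘(ℝ, E) x).symm) (extChartAt 𝓘(ℝ, E) x y)) (a : E) :
    dirDeriv R y (frameL x y a)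
      = fderiv ℝ (R ∘ (extChartAt 𝓘(ℝ, E) x).symm) (extChartAt 𝓘(ℝ, E) x y) a := by
  have h1 : R =ᶠ[𝓝 y] (R ∘ (extChartAt 𝓘(ℝ, E) x).symm) ∘ extChartAt 𝓘(ℝ, E) x := by
    filter_upwards [(chartAt E x).open_source.mem_nhds hy] with y' hy'
    simp [hy']
  have h2 : HasMFDerivAt 𝓘(ℝ, E) 𝓘(ℝ, E) (extChartAt 𝓘(ℝ, E) x) y (coordL x y) := by
    rw [coordL_eq_mfderiv hy]
    exact (mdifferentiableAt_extChartAt hy).hasMFDerivAt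
  have h3 := (h.hasFDerivAt.hasMFDerivAt.comp y h2).congr_of_eventuallyEq h1
  rw [dirDeriv, h3.mfderiv]
  exact congrArg (fderiv ℝ (R ∘ (extChartAt 𝓘(ℝ, E) x).symm) (extChartAt 𝓘(ℝ, E) x y))
    (coordL_frameL hy a)

/-- Every tangent vector at `y` extends to the smooth field with constant coordinates. -/
theorem smoothNear_frameL {x y : M} (hy : y ∈ (chartAt E x).source) (a : E) :
    SmoothNear (fun y' => frameL x y' a) y := by
  refine ⟨(chartAt E x).source, (chartAt E x).open_source, hy, ?_⟩
  intro y' hy'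
  have hs : ContMDiffWithinAt 𝓘(ℝ, E) 𝓘(ℝ, E) ∞ (fun y' => coordL x y' (frameL x y' a))
      (chartAt E x).source y' :=
    contMDiffWithinAt_const.congr (fun z hz => coordL_frameL hz a) (coordL_frameL hy' a)
  refine ((trivializationAt E (TangentSpace 𝓘(ℝ, E)) x).contMDiffWithinAt_section _
    (by simpa using hy')).2 (hs.congr (fun z hz => ?_) ?_)
  · exact congrFun (Bundle.Trivialization.coe_linearMapAt_of_mem (R := ℝ) _
      (by simpa using hz)) _ |>.symm
  · exact congrFun (Bundle.Trivialization.coe_linearMapAt_of_mem (R := ℝ) _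
      (by simpa using hy')) _ |>.symm

theorem frameL_eq_inverse {x y : M} (hy : y ∈ (chartAt E x).source) (a : E) :
    frameL x y a = (mfderiv 𝓘(ℝ, E) 𝓘(ℝ, E) (extChartAt 𝓘(ℝ, E) x) y).inverse a := by
  rw [← coordL_eq_mfderiv hy]
  symm
  have : (coordL x y).inverse = frameL x y := ContinuousLinearMap.inverse_eq
    (ContinuousLinearMap.ext (coordL_frameL hy)) (ContinuousLinearMap.ext (frameL_coordL hy))
  exact congrArg (fun L : E →L[ℝ] TangentSpace 𝓘(ℝ, E) y => L a) this

/-- The Lie bracket of vector fields with coordinates `A`, `B` is computed in the chart. -/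
theorem mlieBracket_frameL [CompleteSpace E] {A B : M → E} {x y : M} (hy : y ∈ (chartAt E x).source)
    (hA : DifferentiableAt ℝ (A ∘ (extChartAt 𝓘(ℝ, E) x).symm) (extChartAt 𝓘(ℝ, E) x y))
    (hB : DifferentiableAt ℝ (B ∘ (extChartAt 𝓘(ℝ, E) x).symm) (extChartAt 𝓘(ℝ, E) x y))
    {X Y : ∀ y : M, TangentSpace 𝓘(ℝ, E) y}
    (hX : ∀ᶠ y' in 𝓝 y, X y' = frameL x y' (A y')) (hY : ∀ᶠ y' in 𝓝 y, Y y' = frameL x y' (B y')) :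
    VectorField.mlieBracket 𝓘(ℝ, E) X Y y = frameL x y (VectorField.lieBracket ℝ
      (A ∘ (extChartAt 𝓘(ℝ, E) x).symm) (B ∘ (extChartAt 𝓘(ℝ, E) x).symm)
      (extChartAt 𝓘(ℝ, E) x y)) := by
  have key (X : ∀ y : M, TangentSpace 𝓘(ℝ, E) y) (A : M → E)
      (hX : ∀ᶠ y' in 𝓝 y, X y' = frameL x y' (A y')) :
      X =ᶠ[𝓝 y] VectorField.mpullback 𝓘(ℝ, E) 𝓘(ℝ, E) (extChartAt 𝓘(ℝ, E) x)
        (A ∘ (extChartAt 𝓘(ℝ, E) x).symm) := by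
    filter_upwards [(chartAt E x).open_source.mem_nhds hy, hX] with y' hy' h
    rw [h, frameL_eq_inverse hy']
    refine congrArg (mfderiv 𝓘(ℝ, E) 𝓘(ℝ, E) (extChartAt 𝓘(ℝ, E) x) y').inverse ?_
    exact congrArg A ((extChartAt 𝓘(ℝ, E) x).left_inv (by simpa using hy')).symm
  have d (A : M → E)
      (hA : DifferentiableAt ℝ (A ∘ (extChartAt 𝓘(ℝ, E) x).symm) (extChartAt 𝓘(ℝ, E) x y)) :
      MDifferentiableAt 𝓘(ℝ, E) 𝓘(ℝ, E).tangent
      (fun z => (⟨z, (A ∘ (extChartAt 𝓘(ℝ, E) x).symm) z⟩ : TangentBundle 𝓘(ℝ, E) E))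
      (extChartAt 𝓘(ℝ, E) x y) := by
    refine (mdifferentiableAt_section _ _).2 ?_
    simpa [Function.comp_def] using hA.mdifferentiableAt
  have : IsManifold 𝓘(ℝ, E) (minSmoothness ℝ 2) M := by
    rw [minSmoothness_of_isRCLikeNormedField]
    exact IsManifold.of_le (n := ∞) two_le_infty
  rw [(key X A hX).mlieBracket_vectorField_eq (key Y B hY),
    ← VectorField.mpullback_mlieBracket (n := ∞) (d A hA) (d B hB) (contMDiffAt_extChartAt' hy)
      (by rw [minSmoothness_of_isRCLikeNormedField]; exact two_le_infty), frameL_eq_inverse hy]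
  refine congrArg (mfderiv 𝓘(ℝ, E) 𝓘(ℝ, E) (extChartAt 𝓘(ℝ, E) x) y).inverse ?_
  have h := congrFun (VectorField.mlieBracketWithin_eq_lieBracketWithin (𝕜 := ℝ) (s := Set.univ)
    (V := A ∘ (extChartAt 𝓘(ℝ, E) x).symm) (W := B ∘ (extChartAt 𝓘(ℝ, E) x).symm))
    (extChartAt 𝓘(ℝ, E) x y)
  exact h.trans (congrFun (VectorField.lieBracketWithin_univ (𝕜 := ℝ)
    (V := A ∘ (extChartAt 𝓘(ℝ, E) x).symm) (W := B ∘ (extChartAt 𝓘(ℝ, E) x).symm)) _)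

end ChartBracket

/-! ### The Levi-Civita connection and the Nijenhuis tensor in a chart -/

section ChartConnection

variable {E : Type*} [NormedAddCommGroup E] [NormedSpace ℝ E]
variable {M : Type*} [TopologicalSpace M] [ChartedSpace E M]
variable {W : Type*} [NormedAddCommGroup W] [NormedSpace ℝ W]

/-- The derivative at `x` of a function on the manifold, in the preferred chart around `x`. -/
def chartDeriv (R : M → W) (x : M) : E →L[ℝ] W :=
  fderiv ℝ (R ∘ (extChartAt 𝓘(ℝ, E) x).symm) (extChartAt 𝓘(ℝ, E) x x)

/-- The function `R` on the manifold is differentiable at `x`, in the preferred chart. -/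
def ChartDiff (E : Type*) [NormedAddCommGroup E] [NormedSpace ℝ E]
    {M : Type*} [TopologicalSpace M] [ChartedSpace E M] (R : M → W) (x : M) : Prop :=
  DifferentiableAt ℝ (R ∘ (extChartAt 𝓘(ℝ, E) x).symm) (extChartAt 𝓘(ℝ, E) x x)

theorem ChartDiff.hasFDerivAt {R : M → W} {x : M} (h : ChartDiff E R x) :
    HasFDerivAt (R ∘ (extChartAt 𝓘(ℝ, E) x).symm) (chartDeriv R x) (extChartAt 𝓘(ℝ, E) x x) :=
  DifferentiableAt.hasFDerivAt h

theorem extChartAt_symm_self (x : M) :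
    (extChartAt 𝓘(ℝ, E) x).symm (extChartAt 𝓘(ℝ, E) x x) = x :=
  extChartAt_to_inv x

theorem eventually_symm {x : M} {p : M → Prop} (h : ∀ᶠ y in 𝓝 x, p y) :
    ∀ᶠ z in 𝓝 (extChartAt 𝓘(ℝ, E) x x), p ((extChartAt 𝓘(ℝ, E) x).symm z) := by
  have h1 : Filter.Tendsto (extChartAt 𝓘(ℝ, E) x).symm (𝓝 (extChartAt 𝓘(ℝ, E) x x)) (𝓝 x) := by
    have := continuousAt_extChartAt_symm (I := 𝓘(ℝ, E)) x
    rwa [ContinuousAt, extChartAt_symm_self] at this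
  exact h1.eventually h

theorem chartDiff_of_contMDiffAt {R : M → W} {x : M} {k : WithTop ℕ∞}
    (h : ContMDiffAt 𝓘(ℝ, E) 𝓘(ℝ, W) k R x) (hk : k ≠ 0) : ChartDiff E R x :=
  (contDiffAt_comp_symm h).differentiableAt hk

variable [IsManifold 𝓘(ℝ, E) ∞ M]

theorem bilinRep_self (x : M)
    (b : ∀ y : M, TangentSpace 𝓘(ℝ, E) y →L[ℝ] TangentSpace 𝓘(ℝ, E) y →L[ℝ] ℝ) (v w : E) :
    bilinRep x b x v w = b x v w := by
  change b x (frameL x x v) (frameL x x w) = b x v w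
  rw [frameL_self, frameL_self]

theorem endRep_self (x : M)
    (K : ∀ y : M, TangentSpace 𝓘(ℝ, E) y →L[ℝ] TangentSpace 𝓘(ℝ, E) y) (v : E) :
    endRep x K x v = K x v := by
  change coordL x x (K x (frameL x x v)) = K x v
  rw [frameL_self, coordL_self]

theorem frameL_endRep {x y : M} (hy : y ∈ (chartAt E x).source)
    (K : ∀ y : M, TangentSpace 𝓘(ℝ, E) y →L[ℝ] TangentSpace 𝓘(ℝ, E) y) (a : E) :
    frameL x y (endRep x K y a) = K y (frameL x y a) :=
  frameL_coordL hy _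

theorem chartDiff_bilinRep (g : SemiRiemannianMetric E M) (x : M) :
    ChartDiff E (bilinRep x g.val) x :=
  chartDiff_of_contMDiffAt (contMDiffAt_bilinRep g x) (by simp)

/-- The coefficients of the metric in the definition of the Christoffel symbols are those of
`bilinRep`. -/
theorem fderiv_inChart (g : SemiRiemannianMetric E M) (x : M) (a b c : E) :
    fderiv ℝ (fun z => g.inChart x z b c) (extChartAt 𝓘(ℝ, E) x x) a
      = chartDeriv (bilinRep x g.val) x a b c := by
  have h1 := (chartDiff_bilinRep g x).hasFDerivAt
  have h2 : (fun z => g.inChart x z b c) =ᶠ[𝓝 (extChartAt 𝓘(ℝ, E) x x)]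
      fun z => (bilinRep x g.val ∘ (extChartAt 𝓘(ℝ, E) x).symm) z b c := by
    filter_upwards [extChartAt_target_mem_nhds (I := 𝓘(ℝ, E)) x] with z hz
    rw [SemiRiemannianMetric.inChart, mfderiv_symm_eq_frameL hz, mfderiv_symm_eq_frameL hz]
    rfl
  rw [h2.fderiv_eq]
  have h3 := (h1.clm_apply (hasFDerivAt_const b _)).clm_apply (hasFDerivAt_const c _)
  rw [h3.fderiv]
  simp

/-- Raising the index in the Koszul formula, for a nondegenerate bilinear form. -/
theorem exists_koszul [FiniteDimensional ℝ E] {B : E →L[ℝ] E →L[ℝ] ℝ}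
    (hB : ∀ a, (∀ c, B a c = 0) → a = 0) (D : E →L[ℝ] E →L[ℝ] E →L[ℝ] ℝ) (a b : E) :
    ∃ w : E, ∀ c : E, 2 * B w c = D a b c + D b a c - D c a b := by
  let B' : E →ₗ[ℝ] Module.Dual ℝ E :=
    { toFun := fun w => (B w).toLinearMap
      map_add' := fun v w => by ext; simp
      map_smul' := fun r w => by ext; simp }
  have hinj : Function.Injective B' := by
    rw [injective_iff_map_eq_zero]
    exact fun w hw => hB w fun c => DFunLike.congr_fun hw c
  have hsurj : Function.Surjective B' :=
    (LinearMap.injective_iff_surjective_of_finrank_eq_finrank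
      Subspace.dual_finrank_eq.symm).1 hinj
  obtain ⟨w, hw⟩ := hsurj ((1 / 2 : ℝ) • ((D a b).toLinearMap + (D b a).toLinearMap
    - ((ContinuousLinearMap.apply ℝ ℝ b).comp
      ((ContinuousLinearMap.apply ℝ (E →L[ℝ] ℝ) a).comp D)).toLinearMap))
  refine ⟨w, fun c => ?_⟩
  have h := DFunLike.congr_fun hw c
  simp only [B', LinearMap.coe_mk, AddHom.coe_mk, ContinuousLinearMap.coe_coe,
    LinearMap.smul_apply, LinearMap.sub_apply, LinearMap.add_apply,
    ContinuousLinearMap.comp_apply, ContinuousLinearMap.apply_apply, smul_eq_mul] at h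
  linarith

/-- The Christoffel symbol at `x`, acting on coordinate vectors in the preferred chart around `x`,
which identifies the tangent space at `x` with `E`. -/
def gammaRep (g : SemiRiemannianMetric E M) (x : M) (a b : E) : E := g.christoffel x a b

theorem bilinRep_nondegenerate (g : SemiRiemannianMetric E M) (x : M) (a : E)
    (h : ∀ c, bilinRep x g.val x a c = 0) : a = 0 :=
  g.nondegenerate x a fun c => (bilinRep_self x g.val a c).symm.trans (h c)

/-- The nondegeneracy of the metric makes the Koszul formula define the Christoffel symbol. -/
theorem gammaRep_spec [FiniteDimensional ℝ E] (g : SemiRiemannianMetric E M) (x : M)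
    (a b c : E) :
    2 * bilinRep x g.val x (gammaRep g x a b) c = chartDeriv (bilinRep x g.val) x a b c
      + chartDeriv (bilinRep x g.val) x b a c - chartDeriv (bilinRep x g.val) x c a b := by
  have hw := exists_koszul (bilinRep_nondegenerate g x)
    (chartDeriv (E := E) (W := E →L[ℝ] E →L[ℝ] ℝ) (bilinRep x g.val) x) a b
  have hex : ∃ w : TangentSpace 𝓘(ℝ, E) x, ∀ c : TangentSpace 𝓘(ℝ, E) x,
      2 * g.val x w c =
        fderiv ℝ (fun z => g.inChart x z b c) (extChartAt 𝓘(ℝ, E) x x) a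
        + fderiv ℝ (fun z => g.inChart x z a c) (extChartAt 𝓘(ℝ, E) x x) b
        - fderiv ℝ (fun z => g.inChart x z a b) (extChartAt 𝓘(ℝ, E) x x) c := by
    obtain ⟨w, hw⟩ := hw
    refine ⟨w, fun c => ?_⟩
    exact ((congrArg (2 * ·) (bilinRep_self x g.val w c).symm).trans (hw c)).trans
      (congrArg₂ (· - ·) (congrArg₂ (· + ·) (fderiv_inChart g x a b c) (fderiv_inChart g x b a c))
        (fderiv_inChart g x c a b)).symm
  have h := hex.choose_spec c
  rw [fderiv_inChart, fderiv_inChart, fderiv_inChart] at h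
  have e : gammaRep g x a b = hex.choose := dif_pos hex
  rw [e]
  exact (congrArg (2 * ·) (bilinRep_self x g.val _ c)).trans h

theorem bilinRep_symm (g : SemiRiemannianMetric E M) (x y : M) (a b : E) :
    bilinRep x g.val y a b = bilinRep x g.val y b a :=
  g.symm y _ _

theorem chartDeriv_bilinRep_symm (g : SemiRiemannianMetric E M) (x : M) (a b c : E) :
    chartDeriv (bilinRep x g.val) x a b c = chartDeriv (bilinRep x g.val) x a c b := by
  have h1 := (chartDiff_bilinRep g x).hasFDerivAt
  have h3 (b c) := (h1.clm_apply (hasFDerivAt_const b _)).clm_apply (hasFDerivAt_const c _)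
  have e : (fun z => (bilinRep x g.val ∘ (extChartAt 𝓘(ℝ, E) x).symm) z b c)
    = fun z => (bilinRep x g.val ∘ (extChartAt 𝓘(ℝ, E) x).symm) z c b :=
      funext fun z => bilinRep_symm g x _ b c
  have h4 := h3 b c
  rw [e] at h4
  simpa using DFunLike.congr_fun (h4.unique (h3 c b)) a

/-- The Levi-Civita connection is metric. -/
theorem chartDeriv_bilinRep_eq [FiniteDimensional ℝ E] (g : SemiRiemannianMetric E M) (x : M)
    (a b c : E) :
    chartDeriv (bilinRep x g.val) x a b c = bilinRep x g.val x (gammaRep g x a b) c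
      + bilinRep x g.val x b (gammaRep g x a c) := by
  have h1 := gammaRep_spec g x a b c
  have h2 := gammaRep_spec g x a c b
  rw [bilinRep_symm g x x b]
  rw [chartDeriv_bilinRep_symm g x a c b, chartDeriv_bilinRep_symm g x b a c,
    chartDeriv_bilinRep_symm g x c a b] at h2
  rw [chartDeriv_bilinRep_symm g x b a c, chartDeriv_bilinRep_symm g x c a b] at h1
  linarith

/-- The Levi-Civita connection is torsion-free. -/
theorem gammaRep_symm [FiniteDimensional ℝ E] (g : SemiRiemannianMetric E M) (x : M)
    (a b : E) : gammaRep g x a b = gammaRep g x b a := by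
  refine sub_eq_zero.1 (bilinRep_nondegenerate g x _ fun c => ?_)
  have h1 := gammaRep_spec g x a b c
  have h2 := gammaRep_spec g x b a c
  rw [chartDeriv_bilinRep_symm g x c b a] at h2
  rw [map_sub, sub_apply]
  linarith

/-- The Nijenhuis tensor on coordinate fields. -/
theorem nijenhuis_frameL [CompleteSpace E]
    {K : ∀ y : M, TangentSpace 𝓘(ℝ, E) y →L[ℝ] TangentSpace 𝓘(ℝ, E) y} {x : M}
    (hK : ChartDiff E (endRep x K) x) (a b : E) :
    nijenhuis K (fun y => frameL x y a) (fun y => frameL x y b) x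
      = chartDeriv (endRep x K) x (endRep x K x a) b - chartDeriv (endRep x K) x (endRep x K x b) a
        + endRep x K x (chartDeriv (endRep x K) x b a)
        - endRep x K x (chartDeriv (endRep x K) x a b) := by
  have hx := mem_chart_source E x
  have h1 (a : E) := hK.hasFDerivAt.clm_apply (hasFDerivAt_const a _)
  have h0 (a : E) := hasFDerivAt_const (𝕜 := ℝ) a (extChartAt 𝓘(ℝ, E) x x)
  have ev (a : E) : ∀ᶠ y in 𝓝 x, K y (frameL x y a) = frameL x y (endRep x K y a) := by
    filter_upwards [(chartAt E x).open_source.mem_nhds hx] with y hy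
    rw [frameL_endRep hy]
  have ev0 (a : E) : ∀ᶠ y in 𝓝 x, frameL x y a = frameL x y a := .of_forall fun _ => rfl
  have b1 := mlieBracket_frameL (A := fun _ => a) (B := fun _ => b) hx
    (h0 a).differentiableAt (h0 b).differentiableAt (ev0 a) (ev0 b)
  have b2 := mlieBracket_frameL (A := fun y => endRep x K y a) (B := fun y => endRep x K y b) hx
    (h1 a).differentiableAt (h1 b).differentiableAt (ev a) (ev b)
  have b3 := mlieBracket_frameL (A := fun y => endRep x K y a) (B := fun _ => b) hx
    (h1 a).differentiableAt (h0 b).differentiableAt (ev a) (ev0 b)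
  have b4 := mlieBracket_frameL (A := fun _ => a) (B := fun y => endRep x K y b) hx
    (h0 a).differentiableAt (h1 b).differentiableAt (ev0 a) (ev b)
  have f0 (a : E) : fderiv ℝ ((fun _ : M => a) ∘ (extChartAt 𝓘(ℝ, E) x).symm)
    (extChartAt 𝓘(ℝ, E) x x) = 0 := (h0 a).fderiv
  have f1 (a c : E) : fderiv ℝ ((fun y => endRep x K y a) ∘ (extChartAt 𝓘(ℝ, E) x).symm)
    (extChartAt 𝓘(ℝ, E) x x) c = chartDeriv (endRep x K) x c a := by
    rw [show fderiv ℝ ((fun y => endRep x K y a) ∘ (extChartAt 𝓘(ℝ, E) x).symm)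
      (extChartAt 𝓘(ℝ, E) x x) = _ from (h1 a).fderiv]
    simp
  have s0 := extChartAt_symm_self (E := E) x
  simp only [VectorField.lieBracket, f0, f1, Function.comp_apply, s0, frameL_self,
    zero_apply, sub_zero, sub_self, zero_sub] at b1 b2 b3 b4
  rw [nijenhuis, b1, b2, b3, b4]
  have e (v : E) : K x v = endRep x K x v := (endRep_self x K v).symm
  refine (congrArg₂ (· - ·) (congrArg₂ (· - ·) (congrArg₂ (· + ·) ((congrArg (K x) (e 0)).trans
    (e _)) rfl) (e _)) (e _)).trans ?_
  rw [map_zero, map_zero, map_neg]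
  have fin (p q r : E) : 0 + p - -q - r = p + q - r := by abel
  exact fin _ _ _

end ChartConnection

/-! ### The covariant derivative of a structure tensor in a chart -/

section ChartContact

variable {E : Type*} [NormedAddCommGroup E] [NormedSpace ℝ E]
variable {M : Type*} [TopologicalSpace M] [ChartedSpace E M]

set_option synthInstance.maxHeartbeats 200000 in
/-- `d(dα) = 0`, for a 1-form `α` on a vector space whose exterior derivative is `φ` (without the
factor `1/2`). -/
theorem cyclic_fderiv_eq_zero {α : E → E →L[ℝ] ℝ} {z₀ : E} (hα : ContDiffAt ℝ 2 α z₀)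
    {φ : E → E → E → ℝ} {φ' : E → E → E →L[ℝ] ℝ} (h : ∀ a b, HasFDerivAt (φ a b) (φ' a b) z₀)
    (ev : ∀ a b, ∀ᶠ z in 𝓝 z₀, fderiv ℝ α z a b - fderiv ℝ α z b a = φ a b z) (a b c : E) :
    φ' a b c + φ' b c a + φ' c a b = 0 := by
  have hd : HasFDerivAt (fderiv ℝ α) (fderiv ℝ (fderiv ℝ α) z₀) z₀ :=
    ((hα.fderiv_right (m := 1) (by norm_num)).differentiableAt (by simp)).hasFDerivAt
  have hs : IsSymmSndFDerivAt ℝ α z₀ :=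
    hα.isSymmSndFDerivAt (by rw [minSmoothness_of_isRCLikeNormedField])
  have key (a b c : E) : φ' a b c
      = fderiv ℝ (fderiv ℝ α) z₀ c a b - fderiv ℝ (fderiv ℝ α) z₀ c b a := by
    have e (a b : E) := (hd.clm_apply (hasFDerivAt_const a z₀)).clm_apply (hasFDerivAt_const b z₀)
    have e1 := ((e a b).sub (e b a)).congr_of_eventuallyEq
      ((ev a b).mono fun z hz => hz.symm)
    rw [(h a b).unique e1]
    simp
  rw [key, key, key, hs.eq c a, hs.eq c b, hs.eq a b]
  ring

variable [IsManifold 𝓘(ℝ, E) ∞ M]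

/-- The exterior derivative of a 1-form on coordinate fields, which commute. -/
theorem extD_frameL [CompleteSpace E] {α : ∀ y : M, TangentSpace 𝓘(ℝ, E) y →L[ℝ] ℝ} {x y : M}
    (hy : y ∈ (chartAt E x).source)
    (h : DifferentiableAt ℝ (formRep x α ∘ (extChartAt 𝓘(ℝ, E) x).symm) (extChartAt 𝓘(ℝ, E) x y))
    (a b : E) :
    extD α (fun y => frameL x y a) (fun y => frameL x y b) y
      = (1 / 2) * (fderiv ℝ (formRep x α ∘ (extChartAt 𝓘(ℝ, E) x).symm) (extChartAt 𝓘(ℝ, E) x y) a b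
        - fderiv ℝ (formRep x α ∘ (extChartAt 𝓘(ℝ, E) x).symm) (extChartAt 𝓘(ℝ, E) x y) b a) := by
  have h1 (a : E) := h.hasFDerivAt.clm_apply (hasFDerivAt_const a _)
  have h2 (a b : E) : dirDeriv (fun y => α y (frameL x y b)) y (frameL x y a)
      = fderiv ℝ (formRep x α ∘ (extChartAt 𝓘(ℝ, E) x).symm) (extChartAt 𝓘(ℝ, E) x y) a b := by
    rw [dirDeriv_frameL hy (R := fun y => α y (frameL x y b)) (h1 b).differentiableAt a]
    rw [show fderiv ℝ ((fun y => α y (frameL x y b)) ∘ (extChartAt 𝓘(ℝ, E) x).symm)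
      (extChartAt 𝓘(ℝ, E) x y) = _ from (h1 b).fderiv]
    simp
  have h0 (a : E) := hasFDerivAt_const (𝕜 := ℝ) a (extChartAt 𝓘(ℝ, E) x y)
  have f0 (a : E) : fderiv ℝ ((fun _ : M => a) ∘ (extChartAt 𝓘(ℝ, E) x).symm)
    (extChartAt 𝓘(ℝ, E) x y) = 0 := (h0 a).fderiv
  have b1 := mlieBracket_frameL (A := fun _ => a) (B := fun _ => b) hy
    (h0 a).differentiableAt (h0 b).differentiableAt (.of_forall fun _ => rfl)
    (.of_forall fun _ => rfl)
  simp only [VectorField.lieBracket, f0, zero_apply, sub_zero, map_zero] at b1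
  rw [extD, h2, h2, b1, map_zero, sub_zero]

theorem formRep_comp_symm_hasFDerivAt {α : ∀ y : M, TangentSpace 𝓘(ℝ, E) y →L[ℝ] ℝ} {x : M}
    (h : ChartDiff E (formRep x α) x) (a : E) :
    HasFDerivAt (fun z => formRep x α ((extChartAt 𝓘(ℝ, E) x).symm z) a)
      ((chartDeriv (formRep x α) x).flip a) (extChartAt 𝓘(ℝ, E) x x) := by
  simpa using h.hasFDerivAt.clm_apply (hasFDerivAt_const a _)

/-- If `dκ = g(·, K ·) + ε σ ∧ μ` near `x`, and `dμ = g(·, L ·)` on horizontal vectors at `x`, then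
`d(dκ) = 0` expresses the cyclic sum of the derivative of `g(·, K ·)` through `σ`. -/
theorem closed_of_extD [CompleteSpace E] (g : SemiRiemannianMetric E M)
    {K L : ∀ y : M, TangentSpace 𝓘(ℝ, E) y →L[ℝ] TangentSpace 𝓘(ℝ, E) y}
    {κ μ σ : ∀ y : M, TangentSpace 𝓘(ℝ, E) y →L[ℝ] ℝ} {x : M} {ε : ℝ}
    (hK : ChartDiff E (endRep x K) x)
    (hκ : ContMDiffAt 𝓘(ℝ, E) 𝓘(ℝ, E →L[ℝ] ℝ) 2 (formRep x κ) x)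
    (hμ : ChartDiff E (formRep x μ) x) (hσ : ChartDiff E (formRep x σ) x)
    (dκ : ∀ᶠ y in 𝓝 x, ∀ X Y, SmoothNear X y → SmoothNear Y y → extD κ X Y y
      = g.val y (X y) (K y (Y y))
        + ε * ((1 / 2) * (σ y (X y) * μ y (Y y) - σ y (Y y) * μ y (X y))))
    (dμ : ∀ X Y, SmoothNear X x → SmoothNear Y x → κ x (X x) = 0 → κ x (Y x) = 0 →
      extD μ X Y x = g.val x (X x) (L x (Y x)))
    {a b c : E} (ka : formRep x κ x a = 0) (kb : formRep x κ x b = 0) (kc : formRep x κ x c = 0)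
    (la : formRep x μ x a = 0) (lb : formRep x μ x b = 0) (lc : formRep x μ x c = 0) :
    (chartDeriv (bilinRep x g.val) x c a (endRep x K x b)
        + bilinRep x g.val x a (chartDeriv (endRep x K) x c b))
      + (chartDeriv (bilinRep x g.val) x a b (endRep x K x c)
        + bilinRep x g.val x b (chartDeriv (endRep x K) x a c))
      + (chartDeriv (bilinRep x g.val) x b c (endRep x K x a)
        + bilinRep x g.val x c (chartDeriv (endRep x K) x b a))
      + ε * (formRep x σ x a * bilinRep x g.val x c (endRep x L x b)
        + formRep x σ x b * bilinRep x g.val x a (endRep x L x c)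
        + formRep x σ x c * bilinRep x g.val x b (endRep x L x a)) = 0 := by
  have s0 := extChartAt_symm_self (E := E) x
  have hg := (chartDiff_bilinRep g x).hasFDerivAt
  have hK' := hK.hasFDerivAt
  have hdκ : ∀ᶠ z in 𝓝 (extChartAt 𝓘(ℝ, E) x x), DifferentiableAt ℝ
      (formRep x κ ∘ (extChartAt 𝓘(ℝ, E) x).symm) z :=
    ((contDiffAt_comp_symm hκ).eventually (by simp)).mono fun z hz =>
      hz.differentiableAt (by simp)
  have h1 (a b : E) := (((hg.clm_apply (hasFDerivAt_const a _)).clm_apply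
    (hK'.clm_apply (hasFDerivAt_const b _))).const_mul (2 : ℝ)).add
    ((((formRep_comp_symm_hasFDerivAt hσ a).mul (formRep_comp_symm_hasFDerivAt hμ b)).sub
      ((formRep_comp_symm_hasFDerivAt hσ b).mul (formRep_comp_symm_hasFDerivAt hμ a))).const_mul ε)
  -- The factor `2` of `h1` undoes the normalisation `1/2` of `extD`.
  have h2 := cyclic_fderiv_eq_zero (contDiffAt_comp_symm hκ) h1 (fun a b => ?_) a b c
  · have h3 (a b : E) (ha : formRep x κ x a = 0) (hb : formRep x κ x b = 0) :
        chartDeriv (formRep x μ) x a b - chartDeriv (formRep x μ) x b a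
          = 2 * bilinRep x g.val x a (endRep x L x b) := by
      have hx := mem_chart_source E x
      have e1 := dμ _ _ (smoothNear_frameL hx a) (smoothNear_frameL hx b) ha hb
      rw [extD_frameL hx hμ] at e1
      have e2 : g.val x (frameL x x a) (L x (frameL x x b))
          = bilinRep x g.val x a (endRep x L x b) := by
        rw [← frameL_endRep hx]
        rfl
      rw [e2] at e1
      simp only [chartDeriv]
      linarith
    have h4 := h3 c b kc kb
    have h5 := h3 a c ka kc
    have h6 := h3 b a kb ka
    simp only [add_apply, sub_apply, smul_apply, smul_eq_mul, ContinuousLinearMap.flip_apply,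
      ContinuousLinearMap.comp_apply, Function.comp_apply, s0, la, lb, lc, zero_apply, map_zero,
      zero_mul, zero_add, add_zero] at h2
    linear_combination (1 / 2) * h2 - (ε / 2) * (formRep x σ x a * h4 + formRep x σ x b * h5
      + formRep x σ x c * h6)
  · filter_upwards [hdκ, eventually_symm dκ, extChartAt_target_mem_nhds (I := 𝓘(ℝ, E)) x]
      with z hz hd hzt
    have hy : (extChartAt 𝓘(ℝ, E) x).symm z ∈ (chartAt E x).source := by
      simpa using (extChartAt 𝓘(ℝ, E) x).map_target hzt
    have hr := (extChartAt 𝓘(ℝ, E) x).right_inv hzt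
    have e1 := hd _ _ (smoothNear_frameL hy a) (smoothNear_frameL hy b)
    rw [extD_frameL hy (by rwa [hr]), hr, ← frameL_endRep hy] at e1
    set y := (extChartAt 𝓘(ℝ, E) x).symm z
    change _ = 2 * g.val y (frameL x y a) (frameL x y (endRep x K y b))
      + ε * (σ y (frameL x y a) * μ y (frameL x y b) - σ y (frameL x y b) * μ y (frameL x y a))
    linear_combination 2 * e1

theorem bilinRep_endRep {g : SemiRiemannianMetric E M}
    {K : ∀ y : M, TangentSpace 𝓘(ℝ, E) y →L[ℝ] TangentSpace 𝓘(ℝ, E) y} {x y : M}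
    (hy : y ∈ (chartAt E x).source) (a b : E) :
    bilinRep x g.val y a (endRep x K y b) = g.val y (frameL x y a) (K y (frameL x y b)) := by
  rw [← frameL_endRep hy]
  rfl

theorem bilinRep_endRep_left {g : SemiRiemannianMetric E M}
    {K : ∀ y : M, TangentSpace 𝓘(ℝ, E) y →L[ℝ] TangentSpace 𝓘(ℝ, E) y} {x y : M}
    (hy : y ∈ (chartAt E x).source) (a b : E) :
    bilinRep x g.val y (endRep x K y a) b = g.val y (K y (frameL x y a)) (frameL x y b) := by
  rw [← frameL_endRep hy]
  rfl

/-- The derivative of the skew-symmetry `g(K ·, ·) = -g(·, K ·)`. -/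
theorem chartDeriv_skew {g : SemiRiemannianMetric E M}
    {K : ∀ y : M, TangentSpace 𝓘(ℝ, E) y →L[ℝ] TangentSpace 𝓘(ℝ, E) y} {x : M}
    (hK : ChartDiff E (endRep x K) x)
    (skew : ∀ᶠ y in 𝓝 x, ∀ X Y, g.val y (K y X) Y = -g.val y X (K y Y)) (a b c : E) :
    chartDeriv (bilinRep x g.val) x a (endRep x K x b) c
      + bilinRep x g.val x (chartDeriv (endRep x K) x a b) c
      + chartDeriv (bilinRep x g.val) x a b (endRep x K x c)
      + bilinRep x g.val x b (chartDeriv (endRep x K) x a c) = 0 := by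
  have s0 := extChartAt_symm_self (E := E) x
  have hg := (chartDiff_bilinRep g x).hasFDerivAt
  have hK' := hK.hasFDerivAt
  have h1 := ((hg.clm_apply (hK'.clm_apply (hasFDerivAt_const b _))).clm_apply
      (hasFDerivAt_const c _)).add
    ((hg.clm_apply (hasFDerivAt_const b _)).clm_apply (hK'.clm_apply (hasFDerivAt_const c _)))
  have h2 := h1.congr_of_eventuallyEq (f₁ := fun _ => 0) ?_
  · have h3 := DFunLike.congr_fun (h2.unique (hasFDerivAt_const 0 _)) a
    simp only [add_apply, ContinuousLinearMap.flip_apply,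
      ContinuousLinearMap.comp_apply, Function.comp_apply, s0, zero_apply, map_zero,
      zero_add] at h3
    linarith
  · filter_upwards [eventually_symm skew, extChartAt_target_mem_nhds (I := 𝓘(ℝ, E)) x]
      with z hs hzt
    have hy : (extChartAt 𝓘(ℝ, E) x).symm z ∈ (chartAt E x).source := by
      simpa using (extChartAt 𝓘(ℝ, E) x).map_target hzt
    set y := (extChartAt 𝓘(ℝ, E) x).symm z
    change 0 = bilinRep x g.val y (endRep x K y b) c + bilinRep x g.val y b (endRep x K y c)
    rw [bilinRep_endRep hy, bilinRep_endRep_left hy, hs]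
    ring

/-- The derivative of the relation `K² = -1` modulo vertical vectors. -/
theorem chartDeriv_sq {g : SemiRiemannianMetric E M}
    {K : ∀ y : M, TangentSpace 𝓘(ℝ, E) y →L[ℝ] TangentSpace 𝓘(ℝ, E) y}
    {u v : ∀ y : M, TangentSpace 𝓘(ℝ, E) y →L[ℝ] ℝ} {x : M}
    (hK : ChartDiff E (endRep x K) x)
    (hu : ChartDiff E (formRep x u) x) (hv : ChartDiff E (formRep x v) x)
    (sq : ∀ᶠ y in 𝓝 x, ∀ X Y, g.val y (K y (K y X)) Y
      = -g.val y X Y + u y X * u y Y + v y X * v y Y) (a : E) {b c : E}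
    (hb : formRep x u x b = 0 ∧ formRep x v x b = 0)
    (hc : formRep x u x c = 0 ∧ formRep x v x c = 0)
    (hKK : endRep x K x (endRep x K x b) = -b) :
    bilinRep x g.val x (chartDeriv (endRep x K) x a (endRep x K x b)) c
      + bilinRep x g.val x (endRep x K x (chartDeriv (endRep x K) x a b)) c = 0 := by
  have s0 := extChartAt_symm_self (E := E) x
  have hg := (chartDiff_bilinRep g x).hasFDerivAt
  have hK' := hK.hasFDerivAt
  have h1 := (((hg.clm_apply (hK'.clm_apply (hK'.clm_apply (hasFDerivAt_const b _)))).clm_apply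
      (hasFDerivAt_const c _)).add
    ((hg.clm_apply (hasFDerivAt_const b _)).clm_apply (hasFDerivAt_const c _))).sub
    (((formRep_comp_symm_hasFDerivAt hu b).mul (formRep_comp_symm_hasFDerivAt hu c)).add
    ((formRep_comp_symm_hasFDerivAt hv b).mul (formRep_comp_symm_hasFDerivAt hv c)))
  have h2 := h1.congr_of_eventuallyEq (f₁ := fun _ => 0) ?_
  · have h3 := DFunLike.congr_fun (h2.unique (hasFDerivAt_const 0 _)) a
    simp only [add_apply, sub_apply, smul_apply, smul_eq_mul, ContinuousLinearMap.flip_apply,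
      ContinuousLinearMap.comp_apply, Function.comp_apply, s0, zero_apply, map_zero,
      zero_add, hb.1, hb.2, hc.1, hc.2, zero_mul, hKK, map_add, map_neg, neg_apply] at h3
    linarith
  · filter_upwards [eventually_symm sq, extChartAt_target_mem_nhds (I := 𝓘(ℝ, E)) x]
      with z hs hzt
    have hy : (extChartAt 𝓘(ℝ, E) x).symm z ∈ (chartAt E x).source := by
      simpa using (extChartAt 𝓘(ℝ, E) x).map_target hzt
    set y := (extChartAt 𝓘(ℝ, E) x).symm z
    have e := hs (frameL x y b) (frameL x y c)
    rw [← frameL_endRep hy, ← frameL_endRep hy] at e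
    change 0 = g.val y (frameL x y (endRep x K y (endRep x K y b))) (frameL x y c)
      + g.val y (frameL x y b) (frameL x y c)
      - (u y (frameL x y b) * u y (frameL x y c) + v y (frameL x y b) * v y (frameL x y c))
    rw [e]
    ring

/-- The covariant derivative `∇_a K` at `x` of an endomorphism field, in coordinates. -/
def nabla (g : SemiRiemannianMetric E M) (x : M)
    (K : ∀ y : M, TangentSpace 𝓘(ℝ, E) y →L[ℝ] TangentSpace 𝓘(ℝ, E) y) (a b : E) : E :=
  nablaEnd (gammaRep g x) (endRep x K x) (chartDeriv (endRep x K) x) a b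

theorem endRep_endRep_eq {x : M}
    {K L : ∀ y : M, TangentSpace 𝓘(ℝ, E) y →L[ℝ] TangentSpace 𝓘(ℝ, E) y} {a b : E}
    (h : K x (L x (frameL x x a)) = frameL x x b) : endRep x K x (endRep x L x a) = b := by
  have hx := mem_chart_source E x
  have h2 := congrArg (coordL x x) h
  rw [← frameL_endRep hx L, ← frameL_endRep hx K, coordL_frameL hx, coordL_frameL hx] at h2
  exact h2

/-- The covariant derivative of `K`, one of the two tensors of a contact pair `K, L` with 1-forms
`κ, μ`, as determined by the equations for `dκ`, `dμ` and for the Nijenhuis tensor of `K`. -/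
theorem bilinRep_nabla [FiniteDimensional ℝ E] {g : SemiRiemannianMetric E M}
    {K L : ∀ y : M, TangentSpace 𝓘(ℝ, E) y →L[ℝ] TangentSpace 𝓘(ℝ, E) y}
    {κ μ σ : ∀ y : M, TangentSpace 𝓘(ℝ, E) y →L[ℝ] ℝ} {x : M} {ε : ℝ}
    (hK : ChartDiff E (endRep x K) x)
    (hκ : ContMDiffAt 𝓘(ℝ, E) 𝓘(ℝ, E →L[ℝ] ℝ) 2 (formRep x κ) x)
    (hμ : ChartDiff E (formRep x μ) x) (hσ : ChartDiff E (formRep x σ) x)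
    (dκ : ∀ᶠ y in 𝓝 x, ∀ X Y, SmoothNear X y → SmoothNear Y y → extD κ X Y y
      = g.val y (X y) (K y (Y y))
        + ε * ((1 / 2) * (σ y (X y) * μ y (Y y) - σ y (Y y) * μ y (X y))))
    (dμ : ∀ X Y, SmoothNear X x → SmoothNear Y x → κ x (X x) = 0 → κ x (Y x) = 0 →
      extD μ X Y x = g.val x (X x) (L x (Y x)))
    (skK : ∀ᶠ y in 𝓝 x, ∀ X Y, g.val y (K y X) Y = -g.val y X (K y Y))
    (skL : ∀ X Y, g.val x (L x X) Y = -g.val x X (L x Y))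
    (sq : ∀ᶠ y in 𝓝 x, ∀ X Y, g.val y (K y (K y X)) Y
      = -g.val y X Y + κ y X * κ y Y + μ y X * μ y Y)
    (hor : ∀ X, κ x (K x X) = 0 ∧ μ x (K x X) = 0)
    (hKK : ∀ X, κ x X = 0 → μ x X = 0 → K x (K x X) = -X)
    (hLK : ∀ X, κ x X = 0 → μ x X = 0 → L x (K x X) = -K x (L x X))
    (nij : ∀ X Y, SmoothNear X x → SmoothNear Y x → κ x (X x) = 0 → μ x (X x) = 0 →
      κ x (Y x) = 0 → μ x (Y x) = 0 → ∀ Z, κ x Z = 0 → μ x Z = 0 →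
      g.val x (nijenhuis K X Y x) Z + ε * (σ x (K x (Y x)) * g.val x (L x (X x)) Z
        - σ x (K x (X x)) * g.val x (L x (Y x)) Z
        + σ x (X x) * g.val x (K x (L x (Y x))) Z
        - σ x (Y x) * g.val x (K x (L x (X x))) Z) = 0)
    {a b c : E} (ha : κ x (frameL x x a) = 0 ∧ μ x (frameL x x a) = 0)
    (hb : κ x (frameL x x b) = 0 ∧ μ x (frameL x x b) = 0)
    (hc : κ x (frameL x x c) = 0 ∧ μ x (frameL x x c) = 0) :
    bilinRep x g.val x (nabla g x K a b) c
      = ε * (formRep x σ x a * bilinRep x g.val x (endRep x L x b) c) := by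
  have hx := mem_chart_source E x
  let h : Submodule ℝ E :=
    LinearMap.ker (formRep x κ x).toLinearMap ⊓ LinearMap.ker (formRep x μ x).toLinearMap
  have hKK' (a : E) (ha : a ∈ h) : endRep x K x (endRep x K x a) = -a :=
    endRep_endRep_eq ((hKK _ ha.1 ha.2).trans (map_neg _ _).symm)
  refine nablaEnd_of_normal (h := h) (L := endRep x L x) (bilinRep_symm g x x) (gammaRep_symm g x)
    (chartDeriv_bilinRep_eq g x) (σ := formRep x σ x)
    (fun a _ => ?_) hKK' (fun a c hc => ?_) (fun a b => ?_) (fun a b => ?_) (fun a ha => ?_)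
    (chartDeriv_skew hK skK)
    (fun a b hb c hc => chartDeriv_sq hK (chartDiff_of_contMDiffAt hκ (by simp)) hμ sq a hb hc
      (hKK' b hb))
    (fun a ha b hb c hc =>
      closed_of_extD g hK hκ hμ hσ dκ dμ ha.1 hb.1 hc.1 ha.2 hb.2 hc.2)
    (fun a ha b hb c hc => ?_) ha hb hc
  · change κ x (frameL x x _) = 0 ∧ μ x (frameL x x _) = 0
    rw [frameL_endRep hx]
    exact hor _
  · rw [bilinRep_endRep_left hx, frameL_endRep hx, sq.self_of_nhds]
    rw [show κ x (frameL x x c) = 0 from hc.1, show μ x (frameL x x c) = 0 from hc.2, mul_zero,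
      mul_zero, add_zero, add_zero]
    rfl
  · rw [bilinRep_endRep_left hx, bilinRep_endRep hx, skK.self_of_nhds]
  · rw [bilinRep_endRep_left hx, bilinRep_endRep hx, skL]
  · refine endRep_endRep_eq ((hLK _ ha.1 ha.2).trans ?_)
    rw [map_neg, frameL_endRep hx, frameL_endRep hx]
    rfl
  · have e := nij _ _ (smoothNear_frameL hx a) (smoothNear_frameL hx b) ha.1 ha.2 hb.1 hb.2
      (frameL x x c) hc.1 hc.2
    rw [(nijenhuis_frameL hK a b).trans (frameL_self x _).symm] at e
    rw [bilinRep_endRep_left hx, bilinRep_endRep_left hx, bilinRep_endRep_left hx,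
      bilinRep_endRep_left hx, frameL_endRep hx, frameL_endRep hx,
      show formRep x σ x (endRep x K x a) = σ x (K x (frameL x x a)) by
        rw [← frameL_endRep hx]; rfl,
      show formRep x σ x (endRep x K x b) = σ x (K x (frameL x x b)) by
        rw [← frameL_endRep hx]; rfl]
    rw [← e]
    rfl

end ChartContact

/-! ### The structure tensors of a normal complex contact metric manifold -/

section ComplexStructure

variable {E : Type*} [NormedAddCommGroup E] [NormedSpace ℂ E]
variable {M : Type*} [TopologicalSpace M] [ChartedSpace E M]

/-- Multiplication by the imaginary unit. -/
def mulI (E : Type*) [NormedAddCommGroup E] [NormedSpace ℂ E] : E →L[ℝ] E :=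
  Complex.I • ContinuousLinearMap.id ℝ E

theorem mulI_mulI (a : E) : mulI E (mulI E a) = -a := by
  simp [mulI, smul_smul]

theorem J_J (x : M) (X : TangentSpace 𝓘(ℝ, E) x) : J x (J x X) = -X := mulI_mulI (E := E) X

variable [IsManifold 𝓘(ℂ, E) ω M]

/-- The coordinate changes are holomorphic, so they commute with `J`. -/
theorem coordL_J {x y : M} (hy : y ∈ (chartAt E x).source) (X : TangentSpace 𝓘(ℝ, E) y) :
    coordL x y (J y X) = mulI E (coordL x y X) := by
  have h : coordL x y = (tangentBundleCore 𝓘(ℝ, E) M).coordChange (achart E y) (achart E x) y :=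
    TangentBundle.continuousLinearMapAt_trivializationAt_eq_core hy
  have hd : DifferentiableAt ℂ (extChartAt 𝓘(ℂ, E) x ∘ (extChartAt 𝓘(ℂ, E) y).symm)
      (extChartAt 𝓘(ℂ, E) y y) := by
    have := contDiffWithinAt_ext_coord_change (I := 𝓘(ℂ, E)) (n := ω) x y
      (y := extChartAt 𝓘(ℂ, E) y y) (by simp [hy])
    rw [ModelWithCorners.range_eq_univ, contDiffWithinAt_univ] at this
    exact this.differentiableAt (by simp)
  obtain ⟨L, hL⟩ := hd
  have h2 : HasFDerivAt (extChartAt 𝓘(ℝ, E) x ∘ (extChartAt 𝓘(ℝ, E) y).symm)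
      (L.restrictScalars ℝ) (extChartAt 𝓘(ℝ, E) y y) := hL.restrictScalars ℝ
  have h3 : (tangentBundleCore 𝓘(ℝ, E) M).coordChange (achart E y) (achart E x) y
      = L.restrictScalars ℝ := by
    rw [tangentBundleCore_coordChange_achart, ModelWithCorners.range_eq_univ, fderivWithin_univ]
    exact h2.fderiv
  rw [h, h3]
  exact L.map_smul Complex.I X

theorem endRep_J {x y : M} (hy : y ∈ (chartAt E x).source) : endRep x J y = mulI E := by
  ext a
  change coordL x y (J y (frameL x y a)) = _
  rw [coordL_J hy, coordL_frameL hy]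

end ComplexStructure

namespace ComplexContactTensors

variable {n : ℕ} {ι : Type*} {E : Type*} [NormedAddCommGroup E] [NormedSpace ℂ E]
variable {M : Type*} [TopologicalSpace M] [ChartedSpace E M] [IsManifold 𝓘(ℂ, E) ω M]
variable {C : ComplexContactTensors n ι E M} {i : ι} {x : M}

theorem H_apply (X : TangentSpace 𝓘(ℝ, E) x) : C.H i x X = C.G i x (J x X) := rfl

theorem v_apply (X : TangentSpace 𝓘(ℝ, E) x) : C.v i x X = C.u i x (J x X) := rfl

theorem H_J (X : TangentSpace 𝓘(ℝ, E) x) : C.H i x (J x X) = -C.G i x X := by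
  rw [H_apply, J_J, map_neg]

theorem isHorizontal_J {X : TangentSpace 𝓘(ℝ, E) x} (hX : C.IsHorizontal i x X) :
    C.IsHorizontal i x (J x X) := by
  refine ⟨hX.2, ?_⟩
  rw [v_apply, J_J, map_neg, hX.1, neg_zero]

namespace IsAlmostContactMetric

theorem g_J (hC : C.IsAlmostContactMetric) (X Y : TangentSpace 𝓘(ℝ, E) x) :
    C.g.val x (J x X) Y = -C.g.val x X (J x Y) := by
  rw [← hC.hermitian x X (J x Y), J_J, map_neg, neg_neg]

theorem V_dual (hC : C.IsAlmostContactMetric) (hx : x ∈ C.O i) (X : TangentSpace 𝓘(ℝ, E) x) :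
    C.g.val x (C.V i x) X = C.v i x X := by
  rw [V, map_neg, neg_apply, hC.g_J, neg_neg, hC.U_dual i x hx, v_apply]

theorem H_skew (hC : C.IsAlmostContactMetric) (hx : x ∈ C.O i) (X Y : TangentSpace 𝓘(ℝ, E) x) :
    C.g.val x (C.H i x X) Y = -C.g.val x X (C.H i x Y) := by
  rw [H_apply, H_apply, hC.G_skew i x hx, hC.g_J, hC.G_J i x hx, map_neg]

theorem u_G (hC : C.IsAlmostContactMetric) (hx : x ∈ C.O i)
    (X : TangentSpace 𝓘(ℝ, E) x) : C.u i x (C.G i x X) = 0 := by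
  have h := hC.G_skew i x hx (C.U i x) X
  rw [hC.G_U i x hx, hC.U_dual i x hx, map_zero, zero_apply] at h
  linarith

theorem v_G (hC : C.IsAlmostContactMetric) (hx : x ∈ C.O i)
    (X : TangentSpace 𝓘(ℝ, E) x) : C.v i x (C.G i x X) = 0 := by
  have h := hC.u_G hx (J x X)
  rw [hC.G_J i x hx, map_neg, neg_eq_zero] at h
  exact h

theorem isHorizontal_G (hC : C.IsAlmostContactMetric) (hx : x ∈ C.O i)
    (X : TangentSpace 𝓘(ℝ, E) x) :
    C.IsHorizontal i x (C.G i x X) := ⟨hC.u_G hx X, hC.v_G hx X⟩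

theorem isHorizontal_H (hC : C.IsAlmostContactMetric) (hx : x ∈ C.O i)
    (X : TangentSpace 𝓘(ℝ, E) x) :
    C.IsHorizontal i x (C.H i x X) := hC.isHorizontal_G hx _

theorem G_G (hC : C.IsAlmostContactMetric) (hx : x ∈ C.O i)
    {X : TangentSpace 𝓘(ℝ, E) x} (hX : C.IsHorizontal i x X) :
    C.G i x (C.G i x X) = -X := by
  rw [hC.G_sq i x hx, hX.1, hX.2, zero_smul, zero_smul, add_zero, add_zero]

theorem H_H (hC : C.IsAlmostContactMetric) (hx : x ∈ C.O i)
    {X : TangentSpace 𝓘(ℝ, E) x} (hX : C.IsHorizontal i x X) :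
    C.H i x (C.H i x X) = -X := by
  rw [hC.H_sq i x hx, hX.1, hX.2, zero_smul, zero_smul, add_zero, add_zero]

theorem G_H (hC : C.IsAlmostContactMetric) (hx : x ∈ C.O i)
    {X : TangentSpace 𝓘(ℝ, E) x} (hX : C.IsHorizontal i x X) :
    C.G i x (C.H i x X) = -J x X :=
  hC.G_G hx (isHorizontal_J hX)

theorem H_G (hC : C.IsAlmostContactMetric) (hx : x ∈ C.O i)
    {X : TangentSpace 𝓘(ℝ, E) x} (hX : C.IsHorizontal i x X) :
    C.H i x (C.G i x X) = J x X := by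
  have h : J x (C.G i x X) = -C.G i x (J x X) := by rw [hC.G_J i x hx, neg_neg]
  rw [H_apply, h, map_neg, hC.G_G hx (isHorizontal_J hX), neg_neg]

theorem g_G_G (hC : C.IsAlmostContactMetric) (hx : x ∈ C.O i) (X Y : TangentSpace 𝓘(ℝ, E) x) :
    C.g.val x (C.G i x (C.G i x X)) Y
      = -C.g.val x X Y + C.u i x X * C.u i x Y + C.v i x X * C.v i x Y := by
  rw [hC.G_sq i x hx]
  simp only [map_add, map_neg, map_smul, add_apply, neg_apply, smul_apply, smul_eq_mul,
    hC.U_dual i x hx, hC.V_dual hx]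

theorem g_H_H (hC : C.IsAlmostContactMetric) (hx : x ∈ C.O i) (X Y : TangentSpace 𝓘(ℝ, E) x) :
    C.g.val x (C.H i x (C.H i x X)) Y
      = -C.g.val x X Y + C.u i x X * C.u i x Y + C.v i x X * C.v i x Y := by
  rw [hC.H_sq i x hx]
  simp only [map_add, map_neg, map_smul, add_apply, neg_apply, smul_apply, smul_eq_mul,
    hC.U_dual i x hx, hC.V_dual hx]

end IsAlmostContactMetric

section Nabla

/-- The horizontal vectors at `x`, in coordinates. -/
def horRep (C : ComplexContactTensors n ι E M) (i : ι) (x : M) : Submodule ℝ E :=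
  LinearMap.ker (formRep x (C.u i) x).toLinearMap ⊓ LinearMap.ker (formRep x (C.v i) x).toLinearMap

theorem mem_horRep {a : E} : a ∈ C.horRep i x ↔ C.IsHorizontal i x (frameL x x a) := Iff.rfl

theorem endRep_H {y : M} (hy : y ∈ (chartAt E x).source) :
    endRep x (C.H i) y = (endRep x (C.G i) y).comp (mulI E) := by
  ext a
  rw [← endRep_J hy]
  change coordL x y (C.G i y (J y (frameL x y a)))
    = coordL x y (C.G i y (frameL x y (coordL x y (J y (frameL x y a)))))
  rw [frameL_coordL hy]

theorem formRep_v {y : M} (hy : y ∈ (chartAt E x).source) :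
    formRep x (C.v i) y = (formRep x (C.u i) y).comp (mulI E) := by
  ext a
  rw [← endRep_J hy]
  change C.u i y (J y (frameL x y a))
    = C.u i y (frameL x y (coordL x y (J y (frameL x y a))))
  rw [frameL_coordL hy]

theorem contMDiffAt_formRep_u (hx : x ∈ C.O i) :
    ContMDiffAt 𝓘(ℝ, E) 𝓘(ℝ, E →L[ℝ] ℝ) 2 (formRep x (C.u i)) x :=
  (contMDiffAt_formRep (k := ⊤) (C.isOpen_O i) hx (C.u_smooth i)).of_le two_le_infty

theorem contMDiffAt_formRep_v (hx : x ∈ C.O i) :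
    ContMDiffAt 𝓘(ℝ, E) 𝓘(ℝ, E →L[ℝ] ℝ) 2 (formRep x (C.v i)) x := by
  have h := (contMDiffAt_formRep_u hx).clm_comp (contMDiffAt_const (c := mulI E))
  refine h.congr_of_eventuallyEq ?_
  filter_upwards [(chartAt E x).open_source.mem_nhds (mem_chart_source E x)] with y hy
  exact formRep_v hy

theorem chartDiff_formRep_u (hx : x ∈ C.O i) : ChartDiff E (formRep x (C.u i)) x :=
  chartDiff_of_contMDiffAt (contMDiffAt_formRep_u hx) (by simp)

theorem chartDiff_formRep_v (hx : x ∈ C.O i) : ChartDiff E (formRep x (C.v i)) x :=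
  chartDiff_of_contMDiffAt (contMDiffAt_formRep_v hx) (by simp)

theorem chartDiff_formRep_σ (hx : x ∈ C.O i) : ChartDiff E (formRep x (C.σ i)) x :=
  chartDiff_of_contMDiffAt (contMDiffAt_formRep (k := ⊤) (C.isOpen_O i) hx (C.σ_smooth i))
    (by simp)

theorem chartDiff_endRep_G (hx : x ∈ C.O i) : ChartDiff E (endRep x (C.G i)) x :=
  chartDiff_of_contMDiffAt (contMDiffAt_endRep (k := ⊤) (C.isOpen_O i) hx (C.G_smooth i))
    (by simp)

theorem hasFDerivAt_endRep_H (hx : x ∈ C.O i) :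
    HasFDerivAt (endRep x (C.H i) ∘ (extChartAt 𝓘(ℝ, E) x).symm)
      ((ContinuousLinearMap.precomp E (mulI E)).comp (chartDeriv (E := E) (endRep x (C.G i)) x))
      (extChartAt 𝓘(ℝ, E) x x) := by
  have h := (ContinuousLinearMap.precomp E (mulI E)).hasFDerivAt.comp _
    (chartDiff_endRep_G hx).hasFDerivAt
  refine h.congr_of_eventuallyEq ?_
  filter_upwards [eventually_symm (E := E)
    ((chartAt E x).open_source.mem_nhds (mem_chart_source E x))]
    with z hz
  exact endRep_H hz

theorem chartDiff_endRep_H (hx : x ∈ C.O i) : ChartDiff E (endRep x (C.H i)) x :=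
  (hasFDerivAt_endRep_H hx).differentiableAt

theorem chartDeriv_endRep_H (hx : x ∈ C.O i) : chartDeriv (E := E) (endRep x (C.H i)) x
    = (ContinuousLinearMap.precomp E (mulI E)).comp (chartDeriv (E := E) (endRep x (C.G i)) x) :=
  (hasFDerivAt_endRep_H hx).fderiv

theorem hasFDerivAt_endRep_J (x : M) :
    HasFDerivAt (𝕜 := ℝ) (endRep (E := E) x J ∘ (extChartAt 𝓘(ℝ, E) x).symm) 0
      (extChartAt 𝓘(ℝ, E) x x) := by
  refine (hasFDerivAt_const (mulI E) _).congr_of_eventuallyEq ?_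
  filter_upwards [eventually_symm (E := E)
    ((chartAt E x).open_source.mem_nhds (mem_chart_source E x))]
    with z hz
  exact endRep_J hz

variable [FiniteDimensional ℂ E]

/-- `g((∇_a G) b, c) = σ(a) g(H b, c)` for horizontal vectors. -/
theorem bilinRep_nabla_G (hC : C.IsContactMetric) (hN : C.IsNormal) (hx : x ∈ C.O i) {a b c : E}
    (ha : C.IsHorizontal i x (frameL x x a)) (hb : C.IsHorizontal i x (frameL x x b))
    (hc : C.IsHorizontal i x (frameL x x c)) :
    bilinRep x C.g.val x (nabla C.g x (C.G i) a b) c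
      = formRep x (C.σ i) x a * bilinRep x C.g.val x (endRep x (C.H i) x b) c := by
  have hA := hC.toIsAlmostContactMetric
  have hO : ∀ᶠ y in 𝓝 x, y ∈ C.O i := (C.isOpen_O i).mem_nhds hx
  have : FiniteDimensional ℝ E := FiniteDimensional.complexToReal E
  rw [← one_mul (formRep x (C.σ i) x a * _)]
  refine bilinRep_nabla (κ := C.u i) (μ := C.v i) (chartDiff_endRep_G hx)
    (contMDiffAt_formRep_u hx) (chartDiff_formRep_v hx) (chartDiff_formRep_σ hx)
    (hO.mono fun y hy X Y hX hY => ?_) (fun X Y hX hY uX uY => ?_)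
    (hO.mono fun y hy => hA.G_skew i y hy) (hA.H_skew hx) (hO.mono fun y hy => hA.g_G_G hy)
    (hA.isHorizontal_G hx) (fun X h1 h2 => hA.G_G hx ⟨h1, h2⟩) (fun X h1 h2 => ?_)
    (fun X Y hX hY uX vX uY vY Z uZ vZ => ?_) ha hb hc
  · rw [hC.du i y hy X Y hX hY, wedge, one_mul]
  · rw [hC.dv i x hx X Y hX hY, wedge, uX, uY]
    ring
  · rw [hA.H_G hx ⟨h1, h2⟩, hA.G_H hx ⟨h1, h2⟩, neg_neg]
  · have e := congrArg (fun W => C.g.val x W Z) (hN.horizontal i x hx X Y hX hY ⟨uX, vX⟩ ⟨uY, vY⟩).1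
    simp only [tensorS, map_add, map_sub, map_smul, add_apply, sub_apply, smul_apply, smul_eq_mul,
      hA.U_dual i x hx, hA.V_dual hx, uZ, vZ, vX, vY, map_zero, zero_apply] at e
    linarith

/-- `g((∇_a H) b, c) = -σ(a) g(G b, c)` for horizontal vectors. The roles of `u` and `v` are
exchanged, and `ε = -1` accounts for the sign of `σ ∧ u` in the equation for `dv`. -/
theorem bilinRep_nabla_H (hC : C.IsContactMetric) (hN : C.IsNormal) (hx : x ∈ C.O i) {a b c : E}
    (ha : C.IsHorizontal i x (frameL x x a)) (hb : C.IsHorizontal i x (frameL x x b))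
    (hc : C.IsHorizontal i x (frameL x x c)) :
    bilinRep x C.g.val x (nabla C.g x (C.H i) a b) c
      = -(formRep x (C.σ i) x a * bilinRep x C.g.val x (endRep x (C.G i) x b) c) := by
  have hA := hC.toIsAlmostContactMetric
  have hO : ∀ᶠ y in 𝓝 x, y ∈ C.O i := (C.isOpen_O i).mem_nhds hx
  have : FiniteDimensional ℝ E := FiniteDimensional.complexToReal E
  rw [← neg_one_mul (formRep x (C.σ i) x a * _)]
  refine bilinRep_nabla (κ := C.v i) (μ := C.u i) (chartDiff_endRep_H hx)
    (contMDiffAt_formRep_v hx) (chartDiff_formRep_u hx) (chartDiff_formRep_σ hx)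
    (hO.mono fun y hy X Y hX hY => ?_) (fun X Y hX hY uX uY => ?_)
    (hO.mono fun y hy => hA.H_skew hy) (hA.G_skew i x hx)
    (hO.mono fun y hy X Y => (hA.g_H_H hy X Y).trans (add_right_comm _ _ _))
    (fun X => (hA.isHorizontal_H hx X).symm) (fun X h1 h2 => hA.H_H hx ⟨h2, h1⟩)
    (fun X h1 h2 => ?_)
    (fun X Y hX hY vX uX vY uY Z vZ uZ => ?_) ha.symm hb.symm hc.symm
  · rw [hC.dv i y hy X Y hX hY, wedge]
    ring
  · rw [hC.du i x hx X Y hX hY, wedge, uX, uY]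
    ring
  · rw [hA.H_G hx ⟨h2, h1⟩, hA.G_H hx ⟨h2, h1⟩]
  · have e := congrArg (fun W => C.g.val x W Z) (hN.horizontal i x hx X Y hX hY ⟨uX, vX⟩ ⟨uY, vY⟩).2
    rw [hA.H_G hx ⟨uX, vX⟩, hA.H_G hx ⟨uY, vY⟩]
    simp only [tensorT, map_add, map_sub, map_smul, map_neg, add_apply, sub_apply, smul_apply,
      neg_apply, smul_eq_mul, hA.U_dual i x hx, hA.V_dual hx, uZ, vZ, uX, uY, map_zero,
      zero_apply, hA.G_H hx ⟨uX, vX⟩, hA.G_H hx ⟨uY, vY⟩] at e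
    linarith

/-- `g((∇_a J) b, c) = 0` for horizontal vectors, by comparing `∇H = ∇(G J)` with `∇G`. -/
theorem bilinRep_nabla_J (hC : C.IsContactMetric) (hN : C.IsNormal) (hx : x ∈ C.O i) {a b c : E}
    (ha : C.IsHorizontal i x (frameL x x a)) (hb : C.IsHorizontal i x (frameL x x b))
    (hc : C.IsHorizontal i x (frameL x x c)) :
    bilinRep x C.g.val x (nabla C.g x J a b) c = 0 := by
  have hA := hC.toIsAlmostContactMetric
  have hs := mem_chart_source E x
  have hJ : endRep x J x = mulI E := endRep_J hs
  have e : nabla C.g x J a b = nablaEnd (gammaRep C.g x) (mulI E) 0 a b := by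
    rw [nabla, hJ, chartDeriv, (hasFDerivAt_endRep_J x).fderiv]
  rw [e]
  refine nablaEnd_eq_zero_of_comp (h := C.horRep i x) (K := endRep x (C.G i) x)
    (DK := chartDeriv (endRep x (C.G i)) x) (σ := formRep x (C.σ i) x) (fun a _ => ?_)
    (fun a ha => ?_) (fun a ha => endRep_endRep_eq ((hA.G_G hx ha).trans (map_neg _ _).symm))
    mulI_mulI (fun a b => ?_) (fun a ha b hb c hc => ?_) (fun a ha b hb c hc => ?_) ha hb hc
  · rw [mem_horRep, frameL_endRep hs]
    exact hA.isHorizontal_G hx _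
  · rw [mem_horRep, ← hJ, frameL_endRep hs]
    exact isHorizontal_J ha
  · rw [bilinRep_endRep_left hs, bilinRep_endRep hs, hA.G_skew i x hx]
  · have h := bilinRep_nabla_G hC hN hx ha hb hc
    rwa [endRep_H hs] at h
  · have h := bilinRep_nabla_H hC hN hx ha hb hc
    rwa [nabla, endRep_H hs, chartDeriv_endRep_H hx] at h

end Nabla

end ComplexContactTensors

/-! ### The Levi-Civita connection along an immersion -/

section Along

variable {E : Type*} [NormedAddCommGroup E] [NormedSpace ℝ E]
variable {M : Type*} [TopologicalSpace M] [ChartedSpace E M] [IsManifold 𝓘(ℝ, E) ∞ M]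
variable {F : Type*} [NormedAddCommGroup F] [NormedSpace ℝ F]
variable {N : Type*} [TopologicalSpace N] [ChartedSpace F N] [IsManifold 𝓘(ℝ, F) ∞ N]
variable {W : Type*} [NormedAddCommGroup W] [NormedSpace ℝ W]

theorem ChartDiff.mfderiv_apply {R : N → W} {p : N} (h : ChartDiff F R p)
    (v : TangentSpace 𝓘(ℝ, F) p) :
    mfderiv 𝓘(ℝ, F) 𝓘(ℝ, W) R p v = chartDeriv (E := F) R p v := by
  have hp := mem_chart_source F p
  have h1 : R =ᶠ[𝓝 p] (R ∘ (extChartAt 𝓘(ℝ, F) p).symm) ∘ extChartAt 𝓘(ℝ, F) p := by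
    filter_upwards [(chartAt F p).open_source.mem_nhds hp] with y' hy'
    simp [hy']
  have h2 : HasMFDerivAt 𝓘(ℝ, F) 𝓘(ℝ, F) (extChartAt 𝓘(ℝ, F) p) p (coordL p p) := by
    rw [coordL_eq_mfderiv hp]
    exact (mdifferentiableAt_extChartAt hp).hasMFDerivAt
  have h3 := ((DifferentiableAt.hasFDerivAt h).hasMFDerivAt.comp p h2).congr_of_eventuallyEq h1
  rw [h3.mfderiv]
  exact congrArg (chartDeriv (E := F) R p) (coordL_self p v)

/-- The map `f` in the preferred charts around `p` and `f p`. -/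
def mapRep (f : N → M) (p : N) : F → E :=
  (extChartAt 𝓘(ℝ, E) (f p) ∘ f) ∘ (extChartAt 𝓘(ℝ, F) p).symm

theorem contDiffAt_mapRep {f : N → M} {p : N} (hf : ContMDiff 𝓘(ℝ, F) 𝓘(ℝ, E) ∞ f) :
    ContDiffAt ℝ ∞ (mapRep (E := E) (F := F) f p) (extChartAt 𝓘(ℝ, F) p p) :=
  contDiffAt_comp_symm ((contMDiffAt_extChartAt (n := ∞)).comp p (hf p))

/-- The differential of `f`, in the preferred charts around `p` and `f p`. -/
theorem coordL_mfderiv {f : N → M} {p : N} (hf : ContMDiff 𝓘(ℝ, F) 𝓘(ℝ, E) ∞ f) :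
    ∀ᶠ q in 𝓝 p, ∀ v : TangentSpace 𝓘(ℝ, F) q,
      coordL (f p) (f q) (mfderiv 𝓘(ℝ, F) 𝓘(ℝ, E) f q v)
        = fderiv ℝ (mapRep (E := E) (F := F) f p) (extChartAt 𝓘(ℝ, F) p q) (coordL p q v) := by
  have h1 : ∀ᶠ q in 𝓝 p, DifferentiableAt ℝ (mapRep (E := E) (F := F) f p)
      (extChartAt 𝓘(ℝ, F) p q) := by
    have := ((contDiffAt_mapRep (E := E) (F := F) (p := p) hf).of_le
      two_le_infty).eventually (by simp)
    exact (continuousAt_extChartAt (I := 𝓘(ℝ, F)) p).eventually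
      (this.mono fun z hz => hz.differentiableAt (by simp))
  have h2 : ∀ᶠ q in 𝓝 p, f q ∈ (chartAt E (f p)).source :=
    hf.continuous.continuousAt.eventually
      ((chartAt E (f p)).open_source.mem_nhds (mem_chart_source E (f p)))
  filter_upwards [h1, h2, (chartAt F p).open_source.mem_nhds (mem_chart_source F p)]
    with q hd hq hqp v
  have e1 : HasMFDerivAt 𝓘(ℝ, E) 𝓘(ℝ, E) (extChartAt 𝓘(ℝ, E) (f p)) (f q) (coordL (f p) (f q)) := by
    rw [coordL_eq_mfderiv hq]
    exact (mdifferentiableAt_extChartAt hq).hasMFDerivAt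
  have e2 := e1.comp q ((hf.mdifferentiable (by simp)) q).hasMFDerivAt
  have e3 : HasMFDerivAt 𝓘(ℝ, F) 𝓘(ℝ, F) (extChartAt 𝓘(ℝ, F) p) q (coordL p q) := by
    rw [coordL_eq_mfderiv hqp]
    exact (mdifferentiableAt_extChartAt hqp).hasMFDerivAt
  have e4 := (hd.hasFDerivAt.hasMFDerivAt.comp q e3).congr_of_eventuallyEq
    (f₁ := extChartAt 𝓘(ℝ, E) (f p) ∘ f) ?_
  · exact DFunLike.congr_fun (hasMFDerivAt_unique e2 e4) v
  · filter_upwards [(chartAt F p).open_source.mem_nhds hqp] with q' hq'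
    simp [mapRep, hq']

/-- A vector field in the preferred chart around `p`. -/
def fieldRep (p : N) (X : ∀ q : N, TangentSpace 𝓘(ℝ, F) q) (q : N) : F := coordL p q (X q)

theorem chartDiff_fieldRep {X : ∀ q : N, TangentSpace 𝓘(ℝ, F) q}
    (hX : SmoothAlongOn (F := F) (fun q : N => q) X Set.univ) (p : N) :
    ChartDiff F (fieldRep p X) p := by
  have h1 := (hX.contMDiffAt (x := p) Filter.univ_mem)
  have h2 : ContMDiffAt 𝓘(ℝ, F) 𝓘(ℝ, F) ∞ (fieldRep p X) p := by
    refine ((Bundle.contMDiffAt_totalSpace.1 h1).2).congr_of_eventuallyEq ?_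
    filter_upwards [(chartAt F p).open_source.mem_nhds (mem_chart_source F p)] with q hq
    exact congrFun (Bundle.Trivialization.coe_linearMapAt_of_mem (R := ℝ) _ (by simpa using hq)) _
  exact chartDiff_of_contMDiffAt h2 (by simp)

theorem mfderiv_eq_fderiv_mapRep {f : N → M} {p : N} (hf : ContMDiff 𝓘(ℝ, F) 𝓘(ℝ, E) ∞ f)
    (v : TangentSpace 𝓘(ℝ, F) p) : mfderiv 𝓘(ℝ, F) 𝓘(ℝ, E) f p v
      = fderiv ℝ (mapRep (E := E) (F := F) f p) (extChartAt 𝓘(ℝ, F) p p) v := by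
  have h := (coordL_mfderiv (p := p) hf).self_of_nhds v
  rwa [coordL_self, coordL_self] at h

/-- The covariant derivative of the image of the tangent field `Y` under the tensor field `K`, in
coordinates. -/
theorem covDeriv_endomorphism (g : SemiRiemannianMetric E M)
    {K : ∀ y : M, TangentSpace 𝓘(ℝ, E) y →L[ℝ] TangentSpace 𝓘(ℝ, E) y} {f : N → M} {p : N}
    (hf : ContMDiff 𝓘(ℝ, F) 𝓘(ℝ, E) ∞ f) (hK : ChartDiff E (endRep (f p) K) (f p))
    {Y : ∀ q : N, TangentSpace 𝓘(ℝ, F) q}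
    (hY : SmoothAlongOn (F := F) (fun q : N => q) Y Set.univ) (a b : F) (hb : Y p = b) :
    g.covDeriv f (fun q => K (f q) (mfderiv 𝓘(ℝ, F) 𝓘(ℝ, E) f q (Y q))) p a
      = chartDeriv (endRep (f p) K) (f p)
          (fderiv ℝ (mapRep (E := E) (F := F) f p) (extChartAt 𝓘(ℝ, F) p p) a)
          (fderiv ℝ (mapRep (E := E) (F := F) f p) (extChartAt 𝓘(ℝ, F) p p) b)
        + endRep (f p) K (f p)
          (fderiv ℝ (fderiv ℝ (mapRep (E := E) (F := F) f p)) (extChartAt 𝓘(ℝ, F) p p) a b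
          + fderiv ℝ (mapRep (E := E) (F := F) f p) (extChartAt 𝓘(ℝ, F) p p)
            (chartDeriv (fieldRep p Y) p a))
        + gammaRep g (f p)
          (fderiv ℝ (mapRep (E := E) (F := F) f p) (extChartAt 𝓘(ℝ, F) p p) a)
          (endRep (f p) K (f p)
            (fderiv ℝ (mapRep (E := E) (F := F) f p) (extChartAt 𝓘(ℝ, F) p p) b)) := by
  set φ := mapRep (E := E) (F := F) f p with hφ
  set z₀ := extChartAt 𝓘(ℝ, F) p p with hz₀
  have hφd := (contDiffAt_mapRep (E := E) (F := F) (p := p) hf).of_le two_le_infty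
  have hd1 : HasFDerivAt φ (fderiv ℝ φ z₀) z₀ := (hφd.differentiableAt (by simp)).hasFDerivAt
  have hd2 : HasFDerivAt (fderiv ℝ φ) (fderiv ℝ (fderiv ℝ φ) z₀) z₀ :=
    ((hφd.fderiv_right (m := 1) (by norm_num)).differentiableAt (by simp)).hasFDerivAt
  have hYd := (chartDiff_fieldRep hY p).hasFDerivAt
  have s0 : (extChartAt 𝓘(ℝ, F) p).symm z₀ = p := extChartAt_symm_self (E := F) p
  have hφ0 : φ z₀ = extChartAt 𝓘(ℝ, E) (f p) (f p) := by
    simp only [hφ, mapRep, Function.comp_apply, s0]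
  have hK' : HasFDerivAt (endRep (f p) K ∘ (extChartAt 𝓘(ℝ, E) (f p)).symm)
      (chartDeriv (endRep (f p) K) (f p)) (φ z₀) := by
    rw [hφ0]
    exact hK.hasFDerivAt
  have hR := (hK'.comp z₀ hd1).clm_apply (hd2.clm_apply hYd)
  let R : N → E := fun q => mfderiv 𝓘(ℝ, E) 𝓘(ℝ, E) (extChartAt 𝓘(ℝ, E) (f p)) (f q)
    (K (f q) (mfderiv 𝓘(ℝ, F) 𝓘(ℝ, E) f q (Y q)))
  have h2 : ∀ᶠ q in 𝓝 p, f q ∈ (chartAt E (f p)).source :=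
    hf.continuous.continuousAt.eventually
      ((chartAt E (f p)).open_source.mem_nhds (mem_chart_source E (f p)))
  have hev : R ∘ (extChartAt 𝓘(ℝ, F) p).symm =ᶠ[𝓝 z₀] fun z =>
      ((endRep (f p) K ∘ (extChartAt 𝓘(ℝ, E) (f p)).symm) ∘ φ) z
        (fderiv ℝ φ z ((fieldRep p Y ∘ (extChartAt 𝓘(ℝ, F) p).symm) z)) := by
    filter_upwards [eventually_symm (E := F) h2,
      eventually_symm (E := F) (coordL_mfderiv (p := p) hf),
      extChartAt_target_mem_nhds (I := 𝓘(ℝ, F)) p] with z hz1 hz2 hz3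
    have hr := (extChartAt 𝓘(ℝ, F) p).right_inv hz3
    have hl : (extChartAt 𝓘(ℝ, E) (f p)).symm (φ z) = f ((extChartAt 𝓘(ℝ, F) p).symm z) :=
      (extChartAt 𝓘(ℝ, E) (f p)).left_inv (by simpa using hz1)
    have e := hz2 (Y ((extChartAt 𝓘(ℝ, F) p).symm z))
    rw [hr] at e
    simp only [Function.comp_apply, hl, fieldRep]
    rw [hφ, ← e]
    set q := (extChartAt 𝓘(ℝ, F) p).symm z
    have e3 : endRep (f p) K (f q) (coordL (f p) (f q) (mfderiv 𝓘(ℝ, F) 𝓘(ℝ, E) f q (Y q)))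
        = coordL (f p) (f q) (K (f q) (mfderiv 𝓘(ℝ, F) 𝓘(ℝ, E) f q (Y q))) := by
      rw [endRep, ContinuousLinearMap.comp_apply, ContinuousLinearMap.comp_apply,
        frameL_coordL hz1]
    rw [e3, coordL_eq_mfderiv hz1]
    rfl
  have hR2 := hR.congr_of_eventuallyEq hev
  have hRd : ChartDiff F R p := hR2.differentiableAt
  have e1 : mfderiv 𝓘(ℝ, F) 𝓘(ℝ, E) R p a = chartDeriv (E := F) R p a := hRd.mfderiv_apply a
  have e2 : chartDeriv (E := F) R p = _ := hR2.fderiv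
  have s1 := extChartAt_symm_self (E := E) (f p)
  have s2 : fieldRep p Y p = b := (coordL_self p (Y p)).trans hb
  have e3 : chartDeriv (E := F) R p a = chartDeriv (endRep (f p) K) (f p) (fderiv ℝ φ z₀ a)
      (fderiv ℝ φ z₀ b)
      + endRep (f p) K (f p) (fderiv ℝ (fderiv ℝ φ) z₀ a b
        + fderiv ℝ φ z₀ (chartDeriv (fieldRep p Y) p a)) := by
    rw [e2]
    simp only [add_apply, ContinuousLinearMap.flip_apply, ContinuousLinearMap.comp_apply,
      Function.comp_apply, hφ0, s0, s1, s2]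
    rw [map_add, map_add]
    abel
  have e4 : K (f p) (mfderiv 𝓘(ℝ, F) 𝓘(ℝ, E) f p (Y p))
      = endRep (f p) K (f p) (fderiv ℝ φ z₀ b) := by
    rw [mfderiv_eq_fderiv_mapRep hf, hb]
    exact (endRep_self (f p) K _).symm
  exact congrArg₂ (fun s t : E => s + t) (e1.trans e3)
    (congrArg₂ (gammaRep g (f p)) (mfderiv_eq_fderiv_mapRep hf a) e4)

/-- `∇_X K Y - ∇_Y K X = (∇_X K) Y - (∇_Y K) X + K [X, Y]` for tangent fields `X`, `Y` of the source
of `f`, as the connection is torsion-free and the second derivative of `f` is symmetric. -/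
theorem covDeriv_endomorphism_sub [FiniteDimensional ℝ E] [CompleteSpace F]
    (g : SemiRiemannianMetric E M)
    {K : ∀ y : M, TangentSpace 𝓘(ℝ, E) y →L[ℝ] TangentSpace 𝓘(ℝ, E) y} {f : N → M} {p : N}
    (hf : ContMDiff 𝓘(ℝ, F) 𝓘(ℝ, E) ∞ f) (hK : ChartDiff E (endRep (f p) K) (f p))
    {X Y : ∀ q : N, TangentSpace 𝓘(ℝ, F) q}
    (hX : SmoothAlongOn (F := F) (fun q : N => q) X Set.univ)
    (hY : SmoothAlongOn (F := F) (fun q : N => q) Y Set.univ) :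
    g.covDeriv f (fun q => K (f q) (mfderiv 𝓘(ℝ, F) 𝓘(ℝ, E) f q (Y q))) p (X p)
      - g.covDeriv f (fun q => K (f q) (mfderiv 𝓘(ℝ, F) 𝓘(ℝ, E) f q (X q))) p (Y p)
      = frameL (f p) (f p)
        (nabla g (f p) K (coordL (f p) (f p) (mfderiv 𝓘(ℝ, F) 𝓘(ℝ, E) f p (X p)))
            (coordL (f p) (f p) (mfderiv 𝓘(ℝ, F) 𝓘(ℝ, E) f p (Y p)))
          - nabla g (f p) K (coordL (f p) (f p) (mfderiv 𝓘(ℝ, F) 𝓘(ℝ, E) f p (Y p)))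
            (coordL (f p) (f p) (mfderiv 𝓘(ℝ, F) 𝓘(ℝ, E) f p (X p))))
      + K (f p) (mfderiv 𝓘(ℝ, F) 𝓘(ℝ, E) f p (VectorField.mlieBracket 𝓘(ℝ, F) X Y p)) := by
  set φ := mapRep (E := E) (F := F) f p with hφ
  set z₀ := extChartAt 𝓘(ℝ, F) p p with hz₀
  have hsymm : ∀ a b : F, fderiv ℝ (fderiv ℝ φ) z₀ a b = fderiv ℝ (fderiv ℝ φ) z₀ b a := by
    have h := ((contDiffAt_mapRep (E := E) (F := F) (p := p) hf).of_le
      two_le_infty).isSymmSndFDerivAt (by rw [minSmoothness_of_isRCLikeNormedField])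
    exact fun a b => h a b
  have hbr : VectorField.mlieBracket 𝓘(ℝ, F) X Y p
      = chartDeriv (fieldRep p Y) p (coordL p p (X p))
        - chartDeriv (fieldRep p X) p (coordL p p (Y p)) := by
    have hs : ∀ Z : ∀ q : N, TangentSpace 𝓘(ℝ, F) q,
        ∀ᶠ q in 𝓝 p, Z q = frameL p q (fieldRep p Z q) := fun Z => by
      filter_upwards [(chartAt F p).open_source.mem_nhds (mem_chart_source F p)] with q hq
      exact (frameL_coordL hq _).symm
    refine (mlieBracket_frameL (mem_chart_source F p) (chartDiff_fieldRep hX p)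
      (chartDiff_fieldRep hY p) (hs X) (hs Y)).trans ((frameL_self p _).trans ?_)
    have s0 := extChartAt_symm_self (E := F) p
    simp only [VectorField.lieBracket, Function.comp_apply, s0]
    rfl
  have key (Z : ∀ q : N, TangentSpace 𝓘(ℝ, F) q) : coordL p p (Z p) = Z p := coordL_self p (Z p)
  have hd (v : TangentSpace 𝓘(ℝ, F) p) : coordL (f p) (f p) (mfderiv 𝓘(ℝ, F) 𝓘(ℝ, E) f p v)
      = fderiv ℝ φ z₀ v := (coordL_self (f p) _).trans (mfderiv_eq_fderiv_mapRep hf v)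
  have hk : K (f p) (mfderiv 𝓘(ℝ, F) 𝓘(ℝ, E) f p (VectorField.mlieBracket 𝓘(ℝ, F) X Y p))
      = endRep (f p) K (f p) (fderiv ℝ φ z₀ (chartDeriv (E := F) (W := F) (fieldRep p Y) p (X p)
        - chartDeriv (E := F) (W := F) (fieldRep p X) p (Y p))) := by
    refine (congrArg (K (f p)) ((mfderiv_eq_fderiv_mapRep hf _).trans
      (congrArg (fderiv ℝ φ z₀) (hbr.trans ?_)))).trans (endRep_self (f p) K _).symm
    exact congrArg₂ (fun s t : F => chartDeriv (E := F) (W := F) (fieldRep p Y) p s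
      - chartDeriv (E := F) (W := F) (fieldRep p X) p t) (key X) (key Y)
  have fin (A B a b : F) (KL : E →L[ℝ] E) (DK : E →L[ℝ] E →L[ℝ] E) (L : F →L[ℝ] E)
      (Q : F →L[ℝ] F →L[ℝ] E) (hQ : ∀ a b, Q a b = Q b a) (Γ : E → E → E)
      (hΓ : ∀ a b, Γ a b = Γ b a) :
      (DK (L A) (L B) + KL (Q A B + L a) + Γ (L A) (KL (L B)))
        - (DK (L B) (L A) + KL (Q B A + L b) + Γ (L B) (KL (L A)))
      = (nablaEnd Γ KL DK (L A) (L B) - nablaEnd Γ KL DK (L B) (L A)) + KL (L (a - b)) := by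
    rw [nablaEnd, nablaEnd, hQ B A, hΓ (L B) (L A)]
    simp only [map_add, map_sub]
    abel
  refine (congrArg₂ (fun s t : E => s - t) (covDeriv_endomorphism g hf hK hY (X p) (Y p) rfl)
    (covDeriv_endomorphism g hf hK hX (Y p) (X p) rfl)).trans ?_
  refine (fin (X p) (Y p) _ _ _ _ _ _ hsymm _ (gammaRep_symm g (f p))).trans ?_
  refine congrArg₂ (fun s t : E => s + t) ?_ hk.symm
  rw [hd, hd]
  exact (frameL_self (f p) _).symm

end Along

/-! ### The projection onto the screen transversal bundle -/

section Screen

variable {E : Type*} [NormedAddCommGroup E] [NormedSpace ℝ E]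
variable {M : Type*} [TopologicalSpace M] [ChartedSpace E M] [IsManifold 𝓘(ℝ, E) 1 M]

/-- The orthogonal projection onto a nondegenerate subspace. -/
theorem SemiRiemannianMetric.exists_sub_mem_orth [FiniteDimensional ℝ E]
    (g : SemiRiemannianMetric E M) {x : M} {D : Submodule ℝ (TangentSpace 𝓘(ℝ, E) x)}
    (hD : D ⊓ g.orth x D = ⊥) (w : TangentSpace 𝓘(ℝ, E) x) : ∃ s ∈ D, w - s ∈ g.orth x D := by
  let B : LinearMap.BilinForm ℝ (TangentSpace 𝓘(ℝ, E) x) :=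
    LinearMap.mk₂ ℝ (fun X Y => g.val x X Y) (by simp) (by simp) (by simp) (by simp)
  have hB : B.IsRefl := fun X Y h => (g.symm x Y X).trans h
  have : FiniteDimensional ℝ (TangentSpace 𝓘(ℝ, E) x) := inferInstanceAs (FiniteDimensional ℝ E)
  have ho : B.orthogonal D = g.orth x D := by
    ext X
    exact forall₂_congr fun Y _ => by
      change g.val x Y X = 0 ↔ g.val x X Y = 0
      rw [g.symm]
  have hc := (LinearMap.BilinForm.isCompl_orthogonal_iff_disjoint (W := D) hB).2
    (by rw [ho, disjoint_iff]; exact hD)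
  have hw : w ∈ D ⊔ B.orthogonal D := by rw [hc.sup_eq_top]; trivial
  obtain ⟨s, hs, t, ht, rfl⟩ := Submodule.mem_sup.1 hw
  refine ⟨s, hs, ?_⟩
  rw [add_sub_cancel_left, ← ho]
  exact ht

variable {F : Type*} [NormedAddCommGroup F] [NormedSpace ℝ F]
variable {N : Type*} [TopologicalSpace N] [ChartedSpace F N] [IsManifold 𝓘(ℝ, F) 1 N]
variable {g : SemiRiemannianMetric E M} {f : N → M} {r : ℕ}

theorem g_mfderiv_of_mem_radical {p : N} {ξ : TangentSpace 𝓘(ℝ, F) p}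
    (hξ : ξ ∈ radical (F := F) g f p) (X : TangentSpace 𝓘(ℝ, F) p) :
    g.val (f p) (mfderiv 𝓘(ℝ, F) 𝓘(ℝ, E) f p ξ) (mfderiv 𝓘(ℝ, F) 𝓘(ℝ, E) f p X) = 0 :=
  hξ _ ⟨X, rfl⟩

namespace ScreenData

variable (D : ScreenData (F := F) g f r) {p : N}

theorem St_le_orth : D.St p ≤ g.orth (f p) (tangentImage (F := F) f p) :=
  le_sup_right.trans (D.St_sup p).le

theorem eq_of_forall_St {s t : TangentSpace 𝓘(ℝ, E) (f p)} (hs : s ∈ D.St p) (ht : t ∈ D.St p)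
    (h : ∀ w ∈ D.St p, g.val (f p) s w = g.val (f p) t w) : s = t := by
  have : s - t ∈ D.St p ⊓ g.orth (f p) (D.St p) :=
    ⟨sub_mem hs ht, fun w hw => by rw [map_sub, sub_apply, h w hw, sub_self]⟩
  rw [D.St_nondegenerate] at this
  exact sub_eq_zero.1 ((Submodule.mem_bot ℝ).1 this)

/-- The dual frames of the radical and of the null transversal bundle, at one point. -/
theorem exists_dual_frames (p : N) : ∃ (ξ : Fin r → TangentSpace 𝓘(ℝ, F) p)
    (η : Fin r → TangentSpace 𝓘(ℝ, E) (f p)),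
    Submodule.span ℝ (Set.range ξ) = radical (F := F) g f p ∧
    Submodule.span ℝ (Set.range η) = D.ltr p ∧
    (∀ j, η j ∈ g.orth (f p) (push f p (D.S p)) ⊓ g.orth (f p) (D.St p)) ∧
    ∀ i j, g.val (f p) (mfderiv 𝓘(ℝ, F) 𝓘(ℝ, E) f p (ξ i)) (η j) = if i = j then 1 else 0 := by
  obtain ⟨Ω, ξ, η, -, hp, -, -, h⟩ := D.ltr_frame p
  obtain ⟨-, h1, h2, h3, -, h4⟩ := h p hp
  exact ⟨fun j => ξ j p, fun j => η j p, h1, h2, h3, h4⟩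

theorem ltr_le : D.ltr p ≤ g.orth (f p) (push f p (D.S p)) ⊓ g.orth (f p) (D.St p) := by
  obtain ⟨ξ, η, -, h2, h3, -⟩ := D.exists_dual_frames p
  rw [← h2, Submodule.span_le]
  rintro _ ⟨j, rfl⟩
  exact h3 j

theorem g_ltr_S {η : TangentSpace 𝓘(ℝ, E) (f p)} (hη : η ∈ D.ltr p)
    {Z : TangentSpace 𝓘(ℝ, F) p} (hZ : Z ∈ D.S p) :
    g.val (f p) η (mfderiv 𝓘(ℝ, F) 𝓘(ℝ, E) f p Z) = 0 :=
  (D.ltr_le hη).1 _ ⟨Z, hZ, rfl⟩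

theorem g_St_ltr {s η : TangentSpace 𝓘(ℝ, E) (f p)} (hs : s ∈ D.St p) (hη : η ∈ D.ltr p) :
    g.val (f p) s η = 0 :=
  (g.symm _ _ _).trans ((D.ltr_le hη).2 s hs)

theorem g_St_mfderiv {s : TangentSpace 𝓘(ℝ, E) (f p)} (hs : s ∈ D.St p)
    (X : TangentSpace 𝓘(ℝ, F) p) : g.val (f p) s (mfderiv 𝓘(ℝ, F) 𝓘(ℝ, E) f p X) = 0 :=
  D.St_le_orth hs _ ⟨X, rfl⟩

/-- The null transversal space is dual to the radical: it represents all linear functionals. -/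
theorem exists_ltr_sub (w : TangentSpace 𝓘(ℝ, E) (f p)) :
    ∃ η ∈ D.ltr p, ∀ ξ ∈ radical (F := F) g f p,
      g.val (f p) (w - η) (mfderiv 𝓘(ℝ, F) 𝓘(ℝ, E) f p ξ) = 0 := by
  obtain ⟨ξ, η, h1, h2, -, h4⟩ := D.exists_dual_frames p
  refine ⟨∑ j, g.val (f p) (mfderiv 𝓘(ℝ, F) 𝓘(ℝ, E) f p (ξ j)) w • η j, ?_, fun ζ hζ => ?_⟩
  · rw [← h2]
    exact sum_mem fun j _ => Submodule.smul_mem _ _ (Submodule.subset_span ⟨j, rfl⟩)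
  · rw [← h1] at hζ
    rw [g.symm]
    induction hζ using Submodule.span_induction with
    | mem ζ hζ =>
      obtain ⟨i, rfl⟩ := hζ
      simp [map_sub, map_sum, h4]
    | zero => simp
    | add a b _ _ ha hb => rw [map_add, map_add, add_apply, ha, hb, add_zero]
    | smul c a _ ha => rw [map_smul, map_smul, smul_apply, ha, smul_zero]

theorem eq_zero_of_mem_ltr {η : TangentSpace 𝓘(ℝ, E) (f p)} (hη : η ∈ D.ltr p)
    (h : ∀ ξ ∈ radical (F := F) g f p,
      g.val (f p) η (mfderiv 𝓘(ℝ, F) 𝓘(ℝ, E) f p ξ) = 0) : η = 0 := by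
  obtain ⟨ξ, η', h1, h2, -, h4⟩ := D.exists_dual_frames p
  rw [← h2] at hη
  obtain ⟨c, rfl⟩ := (Submodule.mem_span_range_iff_exists_fun ℝ).1 hη
  refine Finset.sum_eq_zero fun i _ => ?_
  have h5 := h (ξ i) (by rw [← h1]; exact Submodule.subset_span ⟨i, rfl⟩)
  rw [g.symm] at h5
  simp only [map_sum, map_smul, h4, smul_eq_mul, mul_ite, mul_one, mul_zero,
    Finset.sum_ite_eq, Finset.mem_univ, if_true] at h5
  rw [h5, zero_smul]

theorem eq_zero_of_mem_radical {ρ : TangentSpace 𝓘(ℝ, F) p} (hρ : ρ ∈ radical (F := F) g f p)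
    (h : ∀ η ∈ D.ltr p, g.val (f p) (mfderiv 𝓘(ℝ, F) 𝓘(ℝ, E) f p ρ) η = 0) : ρ = 0 := by
  obtain ⟨ξ, η, h1, h2, -, h4⟩ := D.exists_dual_frames p
  rw [← h1] at hρ
  obtain ⟨c, rfl⟩ := (Submodule.mem_span_range_iff_exists_fun ℝ).1 hρ
  refine Finset.sum_eq_zero fun i _ => ?_
  have h5 := h (η i) (by rw [← h2]; exact Submodule.subset_span ⟨i, rfl⟩)
  simp only [map_sum, map_smul, sum_apply, smul_apply, h4, smul_eq_mul, mul_ite, mul_one, mul_zero,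
    Finset.sum_ite_eq', Finset.mem_univ, if_true] at h5
  rw [h5, zero_smul]

theorem exists_radical_add_screen (X : TangentSpace 𝓘(ℝ, F) p) :
    ∃ ρ ∈ radical (F := F) g f p, ∃ Z ∈ D.S p, ρ + Z = X :=
  Submodule.mem_sup.1 (by rw [(D.S_compl p).sup_eq_top]; trivial)

variable [FiniteDimensional ℝ E]

/-- Every ambient vector splits with respect to `TN ⊕ S(TN^⊥) ⊕ ltr(TN)`: subtracting the
components along the nondegenerate subspaces `S(TN^⊥)` and `S(TN)`, and then one in `ltr(TN)` that
is read off from the pairing with the radical, leaves a vector orthogonal to `TN` and `S(TN^⊥)`,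
hence in the radical. -/
theorem exists_screenTransversal (w : TangentSpace 𝓘(ℝ, E) (f p)) :
    ∃ s ∈ D.St p, w - s ∈ tangentImage (F := F) f p ⊔ D.ltr p := by
  obtain ⟨s, hs, h1⟩ := g.exists_sub_mem_orth (D.St_nondegenerate p) w
  obtain ⟨_, ⟨Z, hZ, rfl⟩, h2⟩ := g.exists_sub_mem_orth (D.S_nondegenerate p) (w - s)
  obtain ⟨η, hη, h3⟩ := D.exists_ltr_sub (w - s - mfderiv 𝓘(ℝ, F) 𝓘(ℝ, E) f p Z)
  refine ⟨s, hs, ?_⟩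
  set y := w - s - mfderiv 𝓘(ℝ, F) 𝓘(ℝ, E) f p Z - η with hy
  have hyT : y ∈ g.orth (f p) (tangentImage (F := F) f p) := by
    rintro _ ⟨X, rfl⟩
    obtain ⟨ρ, hρ, Z', hZ', rfl⟩ := D.exists_radical_add_screen X
    change g.val (f p) y (mfderiv 𝓘(ℝ, F) 𝓘(ℝ, E) f p (ρ + Z')) = 0
    rw [map_add, map_add, h3 ρ hρ, zero_add, hy, map_sub, sub_apply, D.g_ltr_S hη hZ', sub_zero]
    exact h2 _ ⟨Z', hZ', rfl⟩
  have hyS : ∀ t ∈ D.St p, g.val (f p) y t = 0 := fun t ht => by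
    rw [hy, map_sub, map_sub, sub_apply, sub_apply, h1 t ht, g.symm _ _ t, D.g_St_mfderiv ht,
      g.symm _ _ t, D.g_St_ltr ht hη, sub_zero, sub_zero]
  rw [← D.St_sup] at hyT
  obtain ⟨_, ⟨ρ, hρ, rfl⟩, t, ht, hyt⟩ := Submodule.mem_sup.1 hyT
  have ht0 : t = 0 := D.eq_of_forall_St ht (zero_mem _) fun t' ht' => by
    have h := hyS t' ht'
    rw [← hyt, map_add, add_apply, g.symm _ _ t'] at h
    change g.val (f p) t' (mfderiv 𝓘(ℝ, F) 𝓘(ℝ, E) f p ρ) + _ = 0 at h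
    rw [D.g_St_mfderiv ht' ρ, zero_add] at h
    rw [h, map_zero, zero_apply]
  rw [ht0, add_zero] at hyt
  refine Submodule.mem_sup.2 ⟨_, ⟨ρ + Z, rfl⟩, η, hη, ?_⟩
  change mfderiv 𝓘(ℝ, F) 𝓘(ℝ, E) f p (ρ + Z) + η = w - s
  change mfderiv 𝓘(ℝ, F) 𝓘(ℝ, E) f p ρ = y at hyt
  rw [map_add, hyt, hy]
  abel

theorem screenTransversalPart_mem (w : TangentSpace 𝓘(ℝ, E) (f p)) :
    D.screenTransversalPart p w ∈ D.St p := by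
  rw [screenTransversalPart, dif_pos (D.exists_screenTransversal w)]
  exact (D.exists_screenTransversal w).choose_spec.1

/-- The projection onto `S(TN^⊥)` is the orthogonal one, as `TN` and `ltr(TN)` are orthogonal to
`S(TN^⊥)`. -/
theorem g_screenTransversalPart (w : TangentSpace 𝓘(ℝ, E) (f p)) {s : TangentSpace 𝓘(ℝ, E) (f p)}
    (hs : s ∈ D.St p) : g.val (f p) (D.screenTransversalPart p w) s = g.val (f p) w s := by
  rw [screenTransversalPart, dif_pos (D.exists_screenTransversal w)]
  have h := (D.exists_screenTransversal w).choose_spec.2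
  set t := (D.exists_screenTransversal w).choose
  obtain ⟨_, ⟨X, rfl⟩, η, hη, e⟩ := Submodule.mem_sup.1 h
  have h2 : g.val (f p) s (w - t) = 0 := by
    rw [← e, map_add, D.g_St_ltr hs hη, add_zero]
    exact D.g_St_mfderiv hs X
  rw [map_sub, sub_eq_zero] at h2
  rw [g.symm, ← h2, g.symm]

theorem screenTransversalPart_sub (w w' : TangentSpace 𝓘(ℝ, E) (f p)) :
    D.screenTransversalPart p w - D.screenTransversalPart p w'
      = D.screenTransversalPart p (w - w') := by
  refine D.eq_of_forall_St
    (sub_mem (D.screenTransversalPart_mem w) (D.screenTransversalPart_mem w'))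
    (D.screenTransversalPart_mem _) fun s hs => ?_
  rw [map_sub, sub_apply, D.g_screenTransversalPart _ hs, D.g_screenTransversalPart _ hs,
    D.g_screenTransversalPart _ hs, map_sub, sub_apply]

theorem screenTransversalPart_zero : D.screenTransversalPart p 0 = 0 := by
  rw [← sub_self (0 : TangentSpace 𝓘(ℝ, E) (f p)), ← D.screenTransversalPart_sub,
    sub_self, sub_self]

end ScreenData

end Screen

/-! ### Integrability of the screen distribution -/

namespace ComplexContactTensors

variable {n : ℕ} {ι : Type*} {E : Type*} [NormedAddCommGroup E] [NormedSpace ℂ E]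
variable {M : Type*} [TopologicalSpace M] [ChartedSpace E M] [IsManifold 𝓘(ℂ, E) ω M]
variable {C : ComplexContactTensors n ι E M} {i : ι} {x : M}

theorem isHorizontal_iff (hA : C.IsAlmostContactMetric) (hx : x ∈ C.O i)
    {X : TangentSpace 𝓘(ℝ, E) x} :
    C.IsHorizontal i x X ↔ C.g.val x (C.U i x) X = 0 ∧ C.g.val x (C.V i x) X = 0 := by
  rw [hA.U_dual i _ hx, hA.V_dual hx]
  rfl

theorem isHorizontal_Ja (hA : C.IsAlmostContactMetric) (hx : x ∈ C.O i) (a : Fin 3)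
    {X : TangentSpace 𝓘(ℝ, E) x} (hX : C.IsHorizontal i x X) :
    C.IsHorizontal i x (C.Ja a i x X) := by
  fin_cases a
  · exact isHorizontal_J hX
  · exact hA.isHorizontal_G hx X
  · exact hA.isHorizontal_H hx X

theorem g_Ja_Ja (hA : C.IsAlmostContactMetric) (hx : x ∈ C.O i) (a : Fin 3)
    {X : TangentSpace 𝓘(ℝ, E) x} (hX : C.IsHorizontal i x X) (Y : TangentSpace 𝓘(ℝ, E) x) :
    C.g.val x (C.Ja a i x Y) (C.Ja a i x X) = C.g.val x Y X := by
  fin_cases a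
  · exact hA.hermitian x Y X
  · change C.g.val x (C.G i x Y) (C.G i x X) = _
    rw [hA.G_skew i x hx, hA.G_G hx hX, map_neg, neg_neg]
  · change C.g.val x (C.H i x Y) (C.H i x X) = _
    rw [hA.H_skew hx, hA.H_H hx hX, map_neg, neg_neg]

/-- The product of two different tensors `J_a` is, up to sign, the third one, so the pairing reduces
to one of the pairings `g(J_c X, W)`. -/
theorem g_Ja_Ja_of_ne (hA : C.IsAlmostContactMetric) (hx : x ∈ C.O i) {a b : Fin 3} (hab : b ≠ a)
    {X W : TangentSpace 𝓘(ℝ, E) x} (hX : C.IsHorizontal i x X)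
    (h : ∀ c, C.g.val x (C.Ja c i x X) W = 0) :
    C.g.val x (C.Ja b i x X) (C.Ja a i x W) = 0 := by
  have h0 : C.g.val x (J x X) W = 0 := h 0
  have h1 : C.g.val x (C.G i x X) W = 0 := h 1
  have h2 : C.g.val x (C.H i x X) W = 0 := h 2
  have hJ (Y W : TangentSpace 𝓘(ℝ, E) x) : C.g.val x Y (J x W) = -C.g.val x (J x Y) W := by
    rw [hA.g_J, neg_neg]
  have hG (Y W : TangentSpace 𝓘(ℝ, E) x) : C.g.val x Y (C.G i x W) = -C.g.val x (C.G i x Y) W := by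
    rw [hA.G_skew i x hx, neg_neg]
  have hH (Y W : TangentSpace 𝓘(ℝ, E) x) : C.g.val x Y (C.H i x W) = -C.g.val x (C.H i x Y) W := by
    rw [hA.H_skew hx, neg_neg]
  have hJG (Y : TangentSpace 𝓘(ℝ, E) x) : J x (C.G i x Y) = -C.H i x Y := by
    rw [H_apply, hA.G_J i x hx, neg_neg]
  fin_cases a <;> fin_cases b
  · exact absurd rfl hab
  · change C.g.val x (C.G i x X) (J x W) = 0
    rw [hJ, hJG, map_neg, neg_apply, h2, neg_zero, neg_zero]
  · change C.g.val x (C.H i x X) (J x W) = 0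
    rw [hJ, H_apply, hJG, H_J, neg_neg, h1, neg_zero]
  · change C.g.val x (J x X) (C.G i x W) = 0
    rw [hG, ← H_apply, h2, neg_zero]
  · exact absurd rfl hab
  · change C.g.val x (C.H i x X) (C.G i x W) = 0
    rw [hG, hA.G_H hx hX, map_neg, neg_apply, h0, neg_zero, neg_zero]
  · change C.g.val x (J x X) (C.H i x W) = 0
    rw [hH, H_J, map_neg, neg_apply, h1, neg_zero, neg_zero]
  · change C.g.val x (C.G i x X) (C.H i x W) = 0
    rw [hH, hA.H_G hx hX, h0, neg_zero]
  · exact absurd rfl hab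

theorem chartDiff_endRep_Ja (hx : x ∈ C.O i) (a : Fin 3) :
    ChartDiff E (endRep x (C.Ja a i)) x := by
  fin_cases a
  · exact (hasFDerivAt_endRep_J x).differentiableAt
  · exact chartDiff_endRep_G hx
  · exact chartDiff_endRep_H hx

/-- On horizontal vectors, `∇J_a` is a combination of the structure tensors `J_b` with `b ≠ a`. -/
theorem bilinRep_nabla_Ja [FiniteDimensional ℂ E] (hC : C.IsContactMetric) (hN : C.IsNormal)
    (hx : x ∈ C.O i) (a : Fin 3) {X Y Z : TangentSpace 𝓘(ℝ, E) x} (hX : C.IsHorizontal i x X)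
    (hY : C.IsHorizontal i x Y) (hZ : C.IsHorizontal i x Z)
    (h : ∀ b, b ≠ a → C.g.val x (C.Ja b i x Y) Z = 0) :
    C.g.val x (frameL x x (nabla C.g x (C.Ja a i) (coordL x x X) (coordL x x Y))) Z = 0 := by
  have hs := mem_chart_source E x
  have hX' : C.IsHorizontal i x (frameL x x (coordL x x X)) := by rwa [frameL_coordL hs]
  have hY' : C.IsHorizontal i x (frameL x x (coordL x x Y)) := by rwa [frameL_coordL hs]
  have hZ' : C.IsHorizontal i x (frameL x x (coordL x x Z)) := by rwa [frameL_coordL hs]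
  have e (w : E) : C.g.val x (frameL x x w) Z = bilinRep x C.g.val x w (coordL x x Z) := by
    change _ = C.g.val x (frameL x x w) (frameL x x (coordL x x Z))
    rw [frameL_coordL hs]
  have eK (K : ∀ y : M, TangentSpace 𝓘(ℝ, E) y →L[ℝ] TangentSpace 𝓘(ℝ, E) y) :
      bilinRep x C.g.val x (endRep x K x (coordL x x Y)) (coordL x x Z) = C.g.val x (K x Y) Z := by
    rw [← e, frameL_endRep hs, frameL_coordL hs]
  rw [e]
  fin_cases a
  · exact bilinRep_nabla_J hC hN hx hX' hY' hZ'
  · refine (bilinRep_nabla_G hC hN hx hX' hY' hZ').trans ?_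
    rw [eK, show C.g.val x (C.H i x Y) Z = 0 from h 2 (by decide), mul_zero]
  · refine (bilinRep_nabla_H hC hN hx hX' hY' hZ').trans ?_
    rw [eK, show C.g.val x (C.G i x Y) Z = 0 from h 1 (by decide), mul_zero, neg_zero]

variable {F : Type*} [NormedAddCommGroup F] [NormedSpace ℝ F]
variable {N : Type*} [TopologicalSpace N] [ChartedSpace F N]

section Pointwise

variable [IsManifold 𝓘(ℝ, F) 1 N]
variable {f : N → M} {r : ℕ} {D : ScreenData (F := F) C.g f r} {p : N}

namespace IsScreenTransversalAntiInvariant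

theorem Ja_mem_St (hD : C.IsScreenTransversalAntiInvariant D) (hx : f p ∈ C.O i) (a : Fin 3)
    (X : TangentSpace 𝓘(ℝ, F) p) :
    C.Ja a i (f p) (mfderiv 𝓘(ℝ, F) 𝓘(ℝ, E) f p X) ∈ D.St p := by
  obtain ⟨ρ, hρ, Z, hZ, rfl⟩ := D.exists_radical_add_screen X
  rw [map_add, map_add]
  exact add_mem (hD.radical a i p hx ⟨_, ⟨ρ, hρ, rfl⟩, rfl⟩)
    (hD.screen a i p hx ⟨_, ⟨Z, hZ, rfl⟩, rfl⟩)

theorem isHorizontal_mfderiv (hD : C.IsScreenTransversalAntiInvariant D)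
    (hA : C.IsAlmostContactMetric) (hx : f p ∈ C.O i) (X : TangentSpace 𝓘(ℝ, F) p) :
    C.IsHorizontal i (f p) (mfderiv 𝓘(ℝ, F) 𝓘(ℝ, E) f p X) :=
  (isHorizontal_iff hA hx).2 ⟨D.g_St_mfderiv (hD.vertical i p hx).1 X,
    D.g_St_mfderiv (hD.vertical i p hx).2 X⟩

theorem isHorizontal_ltr (hD : C.IsScreenTransversalAntiInvariant D)
    (hA : C.IsAlmostContactMetric) (hx : f p ∈ C.O i) {η : TangentSpace 𝓘(ℝ, E) (f p)}
    (hη : η ∈ D.ltr p) : C.IsHorizontal i (f p) η :=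
  (isHorizontal_iff hA hx).2 ⟨D.g_St_ltr (hD.vertical i p hx).1 hη,
    D.g_St_ltr (hD.vertical i p hx).2 hη⟩

variable [FiniteDimensional ℝ E]

theorem isHorizontal_screenTransversalPart (hD : C.IsScreenTransversalAntiInvariant D)
    (hA : C.IsAlmostContactMetric) (hx : f p ∈ C.O i) {w : TangentSpace 𝓘(ℝ, E) (f p)}
    (hw : C.IsHorizontal i (f p) w) : C.IsHorizontal i (f p) (D.screenTransversalPart p w) := by
  rw [isHorizontal_iff hA hx] at hw ⊢
  have hv := hD.vertical i p hx
  rw [C.g.symm, D.g_screenTransversalPart w hv.1, C.g.symm, C.g.symm _ (C.V i (f p)),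
    D.g_screenTransversalPart w hv.2, C.g.symm _ w (C.V i (f p))]
  exact hw

/-- For a vector that is the sum of `J_a Z`, with `Z` tangent to the submanifold, and a vector of
`D₀`, the component in `J_a Rad TN` is `J_a` of the radical part of `Z`: pairing with `J_a Rad TN`
shows that there is no component in `J_a ltr(TN)`, and then pairing with `J_a ltr(TN)` detects the
one in `J_a Rad TN`. -/
theorem noComponentInJaRad_iff (hD : C.IsScreenTransversalAntiInvariant D)
    (hA : C.IsAlmostContactMetric) (hx : f p ∈ C.O i) (a : Fin 3) {Z : TangentSpace 𝓘(ℝ, F) p}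
    {d : TangentSpace 𝓘(ℝ, E) (f p)} (hd : d ∈ C.dZero D a i p) :
    C.NoComponentInJaRad D a i p (C.Ja a i (f p) (mfderiv 𝓘(ℝ, F) 𝓘(ℝ, E) f p Z) + d) ↔
      Z ∈ D.S p := by
  constructor
  · rintro ⟨_, ⟨η, hη, rfl⟩, Z', hZ', d', hd', e⟩
    obtain ⟨ρ, hρ, Z₀, hZ₀, rfl⟩ := D.exists_radical_add_screen Z
    have hJ (W : TangentSpace 𝓘(ℝ, F) p) := hD.Ja_mem_St hx a W
    have hiso (W W' : TangentSpace 𝓘(ℝ, F) p) := g_Ja_Ja hA hx a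
      (hD.isHorizontal_mfderiv hA hx W') (mfderiv 𝓘(ℝ, F) 𝓘(ℝ, E) f p W)
    have hηξ (ξ : TangentSpace 𝓘(ℝ, F) p) (hξ : ξ ∈ ComplexContact.radical (F := F) C.g f p) :
        C.g.val (f p) η (mfderiv 𝓘(ℝ, F) 𝓘(ℝ, E) f p ξ) = 0 := by
      have h := congrArg (fun w => C.g.val (f p) w
        (C.Ja a i (f p) (mfderiv 𝓘(ℝ, F) 𝓘(ℝ, E) f p ξ))) e
      simp only [map_add, add_apply, hiso, D.g_screenTransversalPart _ (hJ ξ),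
        g_Ja_Ja hA hx a (hD.isHorizontal_mfderiv hA hx ξ) η, hd.2.1 ξ hξ, hd'.2.1 ξ hξ] at h
      rw [C.g.symm, g_mfderiv_of_mem_radical hξ, C.g.symm, g_mfderiv_of_mem_radical hξ, C.g.symm _ _
        (mfderiv 𝓘(ℝ, F) 𝓘(ℝ, E) f p ξ), C.g.symm _ (mfderiv 𝓘(ℝ, F) 𝓘(ℝ, E) f p Z') _,
        g_mfderiv_of_mem_radical hξ] at h
      rw [C.g.symm]
      linarith
    have hη0 := D.eq_zero_of_mem_ltr hη hηξ
    have hρη (η' : TangentSpace 𝓘(ℝ, E) (f p)) (hη' : η' ∈ D.ltr p) :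
        C.g.val (f p) (mfderiv 𝓘(ℝ, F) 𝓘(ℝ, E) f p ρ) η' = 0 := by
      have hπ (W : TangentSpace 𝓘(ℝ, F) p) :
          C.g.val (f p) (C.Ja a i (f p) (mfderiv 𝓘(ℝ, F) 𝓘(ℝ, E) f p W))
            (D.screenTransversalPart p (C.Ja a i (f p) η'))
          = C.g.val (f p) (mfderiv 𝓘(ℝ, F) 𝓘(ℝ, E) f p W) η' := by
        rw [C.g.symm, D.g_screenTransversalPart _ (hJ W), C.g.symm,
          g_Ja_Ja hA hx a (hD.isHorizontal_ltr hA hx hη')]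
      have h := congrArg (fun w => C.g.val (f p) w
        (D.screenTransversalPart p (C.Ja a i (f p) η'))) e
      simp only [hη0, map_zero, D.screenTransversalPart_zero, map_add, add_apply, zero_apply, hπ,
        hd.2.2.1 _ ⟨η', hη', rfl⟩, hd'.2.2.1 _ ⟨η', hη', rfl⟩] at h
      rw [C.g.symm _ (mfderiv 𝓘(ℝ, F) 𝓘(ℝ, E) f p Z₀), D.g_ltr_S hη' hZ₀,
        C.g.symm _ (mfderiv 𝓘(ℝ, F) 𝓘(ℝ, E) f p Z'), D.g_ltr_S hη' hZ'] at h
      linarith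
    rwa [D.eq_zero_of_mem_radical hρ hρη, zero_add]
  · intro hZ
    -- `0` is in `J_a ltr(TN)` as the projection of `J_a 0`.
    refine ⟨0, ⟨0, zero_mem _, ?_⟩, Z, hZ, d, hd, ?_⟩
    · rw [map_zero, D.screenTransversalPart_zero]
    · rw [zero_add]

end IsScreenTransversalAntiInvariant

end Pointwise

variable [IsManifold 𝓘(ℝ, F) ∞ N] [FiniteDimensional ℂ E] [FiniteDimensional ℝ F]
variable {f : N → M} {r : ℕ} {D : ScreenData (F := F) C.g f r} {p : N}

/-- The curl of `∇^s J_a` on fields `X`, `Y` is `J_a [X, Y]` up to a vector of `D₀`. -/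
theorem IsScreenTransversalAntiInvariant.nablaS_sub (hC : C.IsContactMetric) (hN : C.IsNormal)
    (hf : ContMDiff 𝓘(ℝ, F) 𝓘(ℝ, E) ∞ f) (hD : C.IsScreenTransversalAntiInvariant D)
    (hx : f p ∈ C.O i) (a : Fin 3) {X Y : ∀ q : N, TangentSpace 𝓘(ℝ, F) q}
    (hX : SmoothAlongOn (F := F) (fun q : N => q) X Set.univ)
    (hY : SmoothAlongOn (F := F) (fun q : N => q) Y Set.univ) :
    ∃ d ∈ C.dZero D a i p,
      D.nablaS (C.JaField f a i Y) p (X p) - D.nablaS (C.JaField f a i X) p (Y p)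
        = C.Ja a i (f p) (mfderiv 𝓘(ℝ, F) 𝓘(ℝ, E) f p (VectorField.mlieBracket 𝓘(ℝ, F) X Y p))
          + d := by
  have : FiniteDimensional ℝ E := FiniteDimensional.complexToReal E
  have : CompleteSpace F := FiniteDimensional.complete ℝ F
  have hA := hC.toIsAlmostContactMetric
  have e := covDeriv_endomorphism_sub C.g hf (chartDiff_endRep_Ja hx a) hX hY
  set R := frameL (f p) (f p)
        (nabla C.g (f p) (C.Ja a i) (coordL (f p) (f p) (mfderiv 𝓘(ℝ, F) 𝓘(ℝ, E) f p (X p)))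
            (coordL (f p) (f p) (mfderiv 𝓘(ℝ, F) 𝓘(ℝ, E) f p (Y p)))
          - nabla C.g (f p) (C.Ja a i) (coordL (f p) (f p) (mfderiv 𝓘(ℝ, F) 𝓘(ℝ, E) f p (Y p)))
            (coordL (f p) (f p) (mfderiv 𝓘(ℝ, F) 𝓘(ℝ, E) f p (X p)))) with hR
  have hh (W : TangentSpace 𝓘(ℝ, F) p) := hD.isHorizontal_mfderiv hA hx W
  have hRg (W : TangentSpace 𝓘(ℝ, E) (f p)) (hW : C.IsHorizontal i (f p) W)
      (h : ∀ (V : TangentSpace 𝓘(ℝ, F) p) (b : Fin 3), b ≠ a →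
        C.g.val (f p) (C.Ja b i (f p) (mfderiv 𝓘(ℝ, F) 𝓘(ℝ, E) f p V)) W = 0) :
      C.g.val (f p) R W = 0 := by
    rw [hR, map_sub, map_sub, sub_apply,
      bilinRep_nabla_Ja hC hN hx a (hh _) (hh _) hW (h (Y p)),
      bilinRep_nabla_Ja hC hN hx a (hh _) (hh _) hW (h (X p)), sub_zero]
  have hne (W : TangentSpace 𝓘(ℝ, E) (f p)) (hW : ∀ s ∈ D.St p, C.g.val (f p) s W = 0)
      (V : TangentSpace 𝓘(ℝ, F) p) (b : Fin 3) (hb : b ≠ a) :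
      C.g.val (f p) (C.Ja b i (f p) (mfderiv 𝓘(ℝ, F) 𝓘(ℝ, E) f p V)) (C.Ja a i (f p) W) = 0 :=
    g_Ja_Ja_of_ne hA hx hb (hh V) fun c => hW _ (hD.Ja_mem_St hx c V)
  have hT (W : TangentSpace 𝓘(ℝ, F) p) : C.g.val (f p) R
      (C.Ja a i (f p) (mfderiv 𝓘(ℝ, F) 𝓘(ℝ, E) f p W)) = 0 :=
    hRg _ (isHorizontal_Ja hA hx a (hh W)) (hne _ fun s hs => D.g_St_mfderiv hs W)
  refine ⟨D.screenTransversalPart p R, ⟨D.screenTransversalPart_mem R, fun ξ _ => ?_, ?_,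
    fun Z _ => ?_⟩, ?_⟩
  · rw [D.g_screenTransversalPart R (hD.Ja_mem_St hx a ξ), hT]
  · rintro _ ⟨η, hη, rfl⟩
    rw [D.g_screenTransversalPart R (D.screenTransversalPart_mem _)]
    refine hRg _ (hD.isHorizontal_screenTransversalPart hA hx
      (isHorizontal_Ja hA hx a (hD.isHorizontal_ltr hA hx hη))) fun V b hb => ?_
    rw [C.g.symm, D.g_screenTransversalPart _ (hD.Ja_mem_St hx b V), C.g.symm]
    exact hne η (fun s hs => D.g_St_ltr hs hη) V b hb
  · rw [D.g_screenTransversalPart R (hD.Ja_mem_St hx a Z), hT]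
  · have hJ := hD.Ja_mem_St hx a (VectorField.mlieBracket 𝓘(ℝ, F) X Y p)
    refine D.eq_of_forall_St (sub_mem (D.screenTransversalPart_mem _)
      (D.screenTransversalPart_mem _)) (add_mem hJ (D.screenTransversalPart_mem _)) fun s hs => ?_
    rw [ScreenData.nablaS, ScreenData.nablaS, D.screenTransversalPart_sub,
      D.g_screenTransversalPart _ hs, map_add, add_apply, D.g_screenTransversalPart _ hs]
    refine (congrArg (fun w => C.g.val (f p) w s) e).trans ?_
    rw [map_add, add_apply, add_comm]

end ComplexContactTensors

end ComplexContact

end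

theorem mainTheorem9
    {E : Type*} [NormedAddCommGroup E] [NormedSpace ℂ E] [FiniteDimensional ℂ E]
    {M : Type*} [TopologicalSpace M] [T2Space M] [SecondCountableTopology M]
    [ChartedSpace E M] [IsManifold 𝓘(ℂ, E) ω M]
    {F : Type*} [NormedAddCommGroup F] [NormedSpace ℝ F] [FiniteDimensional ℝ F]
    {N : Type*} [TopologicalSpace N] [T2Space N] [SecondCountableTopology N]
    [ChartedSpace F N] [IsManifold 𝓘(ℝ, F) ∞ N]
    {ι : Type*} (n q r : ℕ) (hdim : Module.finrank ℂ E = 2 * n + 1) (hq : 0 < q) (hqn : q < n)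
    (C : ComplexContact.ComplexContactTensors n ι E M)
    (hC : C.IsContactMetric) (hnormal : C.IsNormal) (hindex : C.g.HasIndex (4 * q))
    (f : N → M) (hf : ComplexContact.IsNullSubmanifold (F := F) C.g f r)
    (D : ComplexContact.ScreenData (F := F) C.g f r)
    (hD : C.IsScreenTransversalAntiInvariant D) (a : Fin 3) :
    ComplexContact.IsIntegrable D.S ↔
      ∀ X Y : ∀ p : N, TangentSpace 𝓘(ℝ, F) p,
        ComplexContact.IsSection D.S X → ComplexContact.IsSection D.S Y →
        ∀ (i : ι) (p : N), f p ∈ C.O i →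
          C.NoComponentInJaRad D a i p
            (D.nablaS (C.JaField f a i Y) p (X p) - D.nablaS (C.JaField f a i X) p (Y p)) := by
  have : FiniteDimensional ℝ E := FiniteDimensional.complexToReal E
  have key (X Y : ∀ p : N, TangentSpace 𝓘(ℝ, F) p) (hX : ComplexContact.IsSection D.S X)
      (hY : ComplexContact.IsSection D.S Y) (i : ι) (p : N) (hx : f p ∈ C.O i) :
      C.NoComponentInJaRad D a i p
        (D.nablaS (C.JaField f a i Y) p (X p) - D.nablaS (C.JaField f a i X) p (Y p)) ↔
      VectorField.mlieBracket 𝓘(ℝ, F) X Y p ∈ D.S p := by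
    obtain ⟨d, hd, e⟩ := hD.nablaS_sub hC hnormal hf.smooth hx a hX.1 hY.1
    rw [e, hD.noComponentInJaRad_iff hC.toIsAlmostContactMetric hx a hd]
  constructor
  · exact fun h X Y hX hY i p hx => (key X Y hX hY i p hx).2 (h X Y hX hY p)
  · intro h X Y hX hY p
    obtain ⟨i, hx⟩ := C.cover (f p)
    exact (key X Y hX hY i p hx).1 (h X Y hX hY i p hx)
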